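/- Let $\pi:E\to M$ be a smooth submersion between smooth manifolds (for instance the projection of a smooth fibre bundle), $\dim M=n$, $\dim E=m=n+k\ge 1$. Let $L_\pi E$ be the adapted frame bundle: its points are the frames $u=(e_i,e_A)_e$ ($1\le i\le n$, $1\le A\le k$) of the tangent spaces $T_eE$, $e\in E$, with $\pi_*(e_A)=0$ for all $A$. It is a smooth manifold (with the charts given by coordinates of $E$ adapted to $\pi$ and the components of the frame in these coordinates), with projection $\lambda:L_\pi E\to E$ and a right action of the group of invertible block lower triangular matrices. For $X\in T_u(L_\pi E)$ let $\theta^i(X),\theta^A(X)$ be the components of $\lambda_*X$ with respect to the frame $u$ (the soldering form). For a matrix $\xi$ in the Lie algebra of this group let $\xi^*(u)=\frac{d}{dt}\big|_{t=0}u\cdot\exp(t\xi)$ be the fundamental vertical vector field, and let $E^{*i}_j$, $E^{*A}_B$, $E^{*i}_A$ be the fundamental fields of the matrix units, which move $e_i$ in the direction $e_j$, $e_A$ in the direction $e_B$, and $e_i$ in the direction $e_A$, respectively. Let $L:L_\pi E\to\mathbb R$ be a smooth lifted Lagrangian, i.e. $E^{*i}_j(L)=0$ and $E^{*A}_B(L)=0$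 for all $i,j,A,B$, and assume that $L$ is non-zero, i.e. $L(u)\neq0$ for every $u$. Let $\tau(n)>0$ and let $\hat\theta_L=(\theta^i_L,\theta^A_L)$ be the $\mathbb R^m$-valued $1$-form of the Cartan–Hamilton–Poincaré $1$-forms $$\theta^i_L=\tau(n)\,L\,\theta^i+\sum_{A}E^{*i}_A(L)\,\theta^A,\qquad \theta^A_L=\theta^A .$$ Then $(L_\pi E,d\hat\theta_L)$ is a (general) $m$-symplectic manifold: $1\le m\le\dim L_\pi E$, and $d\hat\theta_L$ is a smooth $\mathbb R^m$-valued $2$-form on the manifold $L_\pi E$ that is closed, $d(d\hat\theta_L)=0$, and non-degenerate, i.e. for $X\in T_u(L_\pi E)$ one has $d\hat\theta_L(X,Y)=0$ for all $Y\in T_u(L_\pi E)$ if and only if $X=0$. -/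

import Mathlib

open scoped Manifold ContDiff Topology

/-! ## Vector-valued differential forms on a (boundaryless) smooth manifold -/

namespace ManifoldForm

section

variable {F : Type*} [NormedAddCommGroup F] [NormedSpace ℝ F]
  {P : Type*} [TopologicalSpace P] [ChartedSpace F P]
  {W : Type*} [NormedAddCommGroup W] [NormedSpace ℝ W] {p : ℕ}

/-- The local representative of a `W`-valued `p`-form `α` in a chart `φ`: the pull-back of `α`
under the inverse chart, a form on (an open subset of) the model space. -/
noncomputable def inChart (α : ∀ u : P, TangentSpace 𝓘(ℝ, F) u [⋀^Fin p]→L[ℝ] W)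
    (φ : OpenPartialHomeomorph P F) (z : F) : F [⋀^Fin p]→L[ℝ] W :=
  (α (φ.symm z)).compContinuousLinearMap
    (mfderiv 𝓘(ℝ, F) 𝓘(ℝ, F) φ.symm z : F →L[ℝ] TangentSpace 𝓘(ℝ, F) (φ.symm z))

/-- A form is smooth if all its local representatives in the charts of the atlas are. -/
def IsSmooth (α : ∀ u : P, TangentSpace 𝓘(ℝ, F) u [⋀^Fin p]→L[ℝ] W) : Prop :=
  ∀ φ ∈ atlas F P, ContDiffOn ℝ ∞ (inChart α φ) φ.target

/-- The exterior derivative of a `W`-valued form: at `u` it is computed in the preferred chart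
at `u`. -/
noncomputable def d (α : ∀ u : P, TangentSpace 𝓘(ℝ, F) u [⋀^Fin p]→L[ℝ] W) (u : P) :
    TangentSpace 𝓘(ℝ, F) u [⋀^Fin (p + 1)]→L[ℝ] W :=
  (extDeriv (inChart α (chartAt F u)) (chartAt F u u)).compContinuousLinearMap
    (mfderiv 𝓘(ℝ, F) 𝓘(ℝ, F) (chartAt F u) u : TangentSpace 𝓘(ℝ, F) u →L[ℝ] F)

/-- A `1`-form given as a family of continuous linear maps, regarded as an alternating form. -/
noncomputable def ofOneForm (θ : ∀ u : P, TangentSpace 𝓘(ℝ, F) u →L[ℝ] W) (u : P) :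
    TangentSpace 𝓘(ℝ, F) u [⋀^Fin 1]→L[ℝ] W :=
  ContinuousAlternatingMap.ofSubsingleton ℝ (TangentSpace 𝓘(ℝ, F) u) W (0 : Fin 1) (θ u)

end

/-- A (general) `m`-symplectic structure on the manifold `P`, where `m` is the cardinality of `ι`,
`1 ≤ m ≤ dim P`: a smooth `ℝ^ι`-valued `2`-form which is closed and non-degenerate. -/
structure IsMSymplectic {F : Type*} [NormedAddCommGroup F] [NormedSpace ℝ F]
    {P : Type*} [TopologicalSpace P] [ChartedSpace F P] {ι : Type*} [Fintype ι]
    (α : ∀ u : P, TangentSpace 𝓘(ℝ, F) u [⋀^Fin 2]→L[ℝ] (ι → ℝ)) : Prop where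
  isManifold : IsManifold 𝓘(ℝ, F) ∞ P
  one_le : 1 ≤ Fintype.card ι
  le_dim : Fintype.card ι ≤ Module.finrank ℝ F
  smooth : IsSmooth α
  closed : ∀ u, d α u = 0
  nondegenerate : ∀ (u : P) (X : TangentSpace 𝓘(ℝ, F) u),
    (∀ Y : TangentSpace 𝓘(ℝ, F) u, α u ![X, Y] = 0) ↔ X = 0

end ManifoldForm

/-! ## The adapted frame bundle of a submersion -/

section

variable {n k : ℕ}
  {M : Type*} [TopologicalSpace M] [ChartedSpace (EuclideanSpace ℝ (Fin n)) M]
  {E : Type*} [TopologicalSpace E] [ChartedSpace (EuclideanSpace ℝ (Fin (n + k))) E]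
  {π : E → M}

/-- The adapted frame bundle `L_π E` of a smooth submersion `π : E → M`, with `dim M = n` and
`dim E = n + k`: its points are the frames `(e_i, e_A)` of the tangent spaces of `E` whose last `k`
vectors `e_A` are vertical. -/
@[ext]
structure AdaptedFrameBundle (hπ : Manifold.IsSubmersion (𝓡 (n + k)) (𝓡 n) ∞ π) where
  /-- The base point in `E`. -/
  pt : E
  /-- The frame at the base point. -/
  frame : Module.Basis (Fin n ⊕ Fin k) ℝ (TangentSpace (𝓡 (n + k)) pt)
  vertical : ∀ A : Fin k, mfderiv (𝓡 (n + k)) (𝓡 n) π pt (frame (Sum.inr A)) = 0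

namespace AdaptedFrameBundle

/-- A chart of `E` is adapted to `π` if in it, and in some chart of `M`, the map `π` is the
projection to the first `n` coordinates. -/
def IsAdaptedChart (π : E → M)
    (φ : OpenPartialHomeomorph E (EuclideanSpace ℝ (Fin (n + k)))) : Prop :=
  φ ∈ IsManifold.maximalAtlas (𝓡 (n + k)) ∞ E ∧
  ∃ ψ ∈ IsManifold.maximalAtlas (𝓡 n) ∞ M, (∀ e ∈ φ.source, π e ∈ ψ.source) ∧
    ∀ e ∈ φ.source, ∀ i : Fin n, ψ (π e) i = φ e (Fin.castAdd k i)

theorem exists_isAdaptedChart [IsManifold (𝓡 (n + k)) ∞ E]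
    (hπ : Manifold.IsSubmersion (𝓡 (n + k)) (𝓡 n) ∞ π) (e : E) :
    ∃ φ : OpenPartialHomeomorph E (EuclideanSpace ℝ (Fin (n + k))),
      IsAdaptedChart π φ ∧ e ∈ φ.source := by
  obtain ⟨F, _, _, hF⟩ := hπ
  obtain ⟨⟨φ, ψ, he, hπe, hφ, hψ, hsub, ℓ, hℓ⟩⟩ := hF e
  have : FiniteDimensional ℝ (EuclideanSpace ℝ (Fin n) × F) := ℓ.toLinearEquiv.finiteDimensional
  have hFfin : FiniteDimensional ℝ F :=
    Module.Finite.of_surjective (LinearMap.snd ℝ (EuclideanSpace ℝ (Fin n)) F)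
      LinearMap.snd_surjective
  have hdim : Module.finrank ℝ F = Module.finrank ℝ (EuclideanSpace ℝ (Fin k)) := by
    have := ℓ.toLinearEquiv.finrank_eq
    rw [Module.finrank_prod] at this
    simp at this ⊢
    omega
  let κ : F ≃L[ℝ] EuclideanSpace ℝ (Fin k) := ContinuousLinearEquiv.ofFinrankEq hdim
  let σ : EuclideanSpace ℝ (Fin (n + k)) ≃L[ℝ] EuclideanSpace ℝ (Fin (n + k)) :=
    (ℓ.trans ((ContinuousLinearEquiv.refl ℝ _).prodCongr κ)).trans
      EuclideanSpace.finAddEquivProd.symm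
  have hσ : ∀ z i, σ z (Fin.castAdd k i) = (ℓ z).1 i := by
    intro z i
    have h1 : (EuclideanSpace.finAddEquivProd (𝕜 := ℝ) (n := n) (m := k) (σ z)).1 = (ℓ z).1 := by
      simp [σ]
    rw [← h1]
    simp [EuclideanSpace.finAddEquivProd, EuclideanSpace.sumEquivProd]
  refine ⟨φ ≫ₕ σ.toHomeomorph.toOpenPartialHomeomorph, ⟨?_, ψ, hψ, ?_, ?_⟩, ?_⟩
  · refine OpenPartialHomeomorph.mem_maximalAtlas_of_contMDiffOn (M := E)
      (I := 𝓡 (n + k)) (n := ∞) _ ?_ ?_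
    · have h1 := contMDiffOn_of_mem_maximalAtlas hφ
      have h2 : ContMDiff (𝓡 (n + k)) (𝓡 (n + k)) ∞ σ := σ.contDiff.contMDiff
      exact (h2.comp_contMDiffOn h1).mono (by simp)
    · have h1 := contMDiffOn_symm_of_mem_maximalAtlas hφ
      have h2 : ContMDiff (𝓡 (n + k)) (𝓡 (n + k)) ∞ σ.symm := σ.symm.contDiff.contMDiff
      refine h1.comp h2.contMDiffOn ?_
      intro z hz
      simpa using hz
  · intro x hx
    exact hsub (by simpa using hx)
  · intro x hx i
    have hx' : x ∈ φ.source := by simpa using hx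
    have := hℓ (x := φ x) (by simpa using φ.map_source hx')
    simp [hx'] at this
    simp [hσ, ← this]
  · simpa using he

theorem IsAdaptedChart.mdifferentiable [IsManifold (𝓡 (n + k)) ∞ E]
    {φ : OpenPartialHomeomorph E (EuclideanSpace ℝ (Fin (n + k)))} (hφ : IsAdaptedChart π φ) :
    φ.MDifferentiable (𝓡 (n + k)) (𝓡 (n + k)) :=
  ⟨(contMDiffOn_of_mem_maximalAtlas hφ.1).mdifferentiableOn (by simp),
    (contMDiffOn_symm_of_mem_maximalAtlas hφ.1).mdifferentiableOn (by simp)⟩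

/-- The differential of a chart of `E` at a point, with values in the model space. -/
noncomputable def chartDeriv (φ : OpenPartialHomeomorph E (EuclideanSpace ℝ (Fin (n + k)))) (e : E) :
    TangentSpace (𝓡 (n + k)) e →L[ℝ] EuclideanSpace ℝ (Fin (n + k)) :=
  mfderiv (𝓡 (n + k)) (𝓡 (n + k)) φ e

theorem IsAdaptedChart.mfderiv_eq_zero_iff [IsManifold (𝓡 (n + k)) ∞ E] [IsManifold (𝓡 n) ∞ M]
    (hπ : Manifold.IsSubmersion (𝓡 (n + k)) (𝓡 n) ∞ π)
    {φ : OpenPartialHomeomorph E (EuclideanSpace ℝ (Fin (n + k)))} (hφ : IsAdaptedChart π φ)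
    {e : E} (he : e ∈ φ.source) (X : TangentSpace (𝓡 (n + k)) e) :
    mfderiv (𝓡 (n + k)) (𝓡 n) π e X = 0 ↔
      ∀ i : Fin n, chartDeriv φ e X (Fin.castAdd k i) = 0 := by
  obtain ⟨-, ψ, hψ, hsub, hcoord⟩ := id hφ
  have hψd : ψ.MDifferentiable (𝓡 n) (𝓡 n) :=
    ⟨(contMDiffOn_of_mem_maximalAtlas hψ).mdifferentiableOn (by simp),
      (contMDiffOn_symm_of_mem_maximalAtlas hψ).mdifferentiableOn (by simp)⟩
  have hπd : MDifferentiableAt (𝓡 (n + k)) (𝓡 n) π e := (hπ.contMDiff e).mdifferentiableAt (by simp)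
  let p : EuclideanSpace ℝ (Fin (n + k)) →L[ℝ] EuclideanSpace ℝ (Fin n) :=
    (ContinuousLinearMap.fst ℝ _ _).comp
      (EuclideanSpace.finAddEquivProd (𝕜 := ℝ) (n := n) (m := k)).toContinuousLinearMap
  have hp : ∀ z i, p z i = z (Fin.castAdd k i) := by
    intro z i
    simp [p, EuclideanSpace.finAddEquivProd, EuclideanSpace.sumEquivProd]
  have hev : ψ ∘ π =ᶠ[𝓝 e] p ∘ φ := by
    filter_upwards [φ.open_source.mem_nhds he] with x hx
    ext i
    simp [hp, hcoord x hx i]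
  have h1 := hev.mfderiv_eq (I := 𝓡 (n + k)) (I' := 𝓡 n)
  have hpd : MDifferentiableAt (𝓡 (n + k)) (𝓡 n) p (φ e) := p.mdifferentiableAt
  rw [mfderiv_comp e (hψd.mdifferentiableAt (hsub e he)) hπd,
    mfderiv_comp e hpd (hφ.mdifferentiable.mdifferentiableAt he)] at h1
  have h2 : mfderiv (𝓡 n) (𝓡 n) ψ (π e) (mfderiv (𝓡 (n + k)) (𝓡 n) π e X) =
      p (chartDeriv φ e X) := by
    have h3 := congrArg (fun T => T X) h1
    have h4 : mfderiv (𝓡 (n + k)) (𝓡 n) p (φ e) = p := by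
      rw [mfderiv_eq_fderiv]; exact p.fderiv
    rw [h4] at h3
    exact h3
  have hinj := hψd.mfderiv_injective (hsub e he)
  constructor
  · intro h i
    rw [h, map_zero] at h2
    rw [← hp, ← h2]
    rfl
  · intro h
    apply hinj
    rw [h2, map_zero]
    have h5 : p (chartDeriv φ e X) = 0 := by
      ext i
      rw [hp, h i]
      rfl
    exact h5

variable {hπ : Manifold.IsSubmersion (𝓡 (n + k)) (𝓡 n) ∞ π}

/-- The frame `u`, regarded as the linear isomorphism `ℝ^{n+k} → T_e E` sending the standard basis
to the frame. -/
noncomputable def frameIso (u : AdaptedFrameBundle hπ) :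
    (Fin n ⊕ Fin k → ℝ) ≃L[ℝ] TangentSpace (𝓡 (n + k)) u.pt :=
  haveI : T2Space (TangentSpace (𝓡 (n + k)) u.pt) :=
    inferInstanceAs (T2Space (EuclideanSpace ℝ (Fin (n + k))))
  u.frame.equivFunL.symm

theorem frameIso_single (u : AdaptedFrameBundle hπ) (a : Fin n ⊕ Fin k) :
    u.frameIso (Pi.single a 1) = u.frame a := by
  change u.frame.equivFun.symm (Pi.single a 1) = u.frame a
  simp

variable (n k) in
/-- The space of the components `(v^i_j, v^A_j, v^A_B)` of adapted frames, that is, of block lower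
triangular `(n + k) × (n + k)` matrices. -/
abbrev FrameModel : Type :=
  (Fin n → Fin n → ℝ) × (Fin k → Fin n → ℝ) × (Fin k → Fin k → ℝ)

/-- The three blocks on and below the diagonal of a linear map. -/
noncomputable def blocks :
    ((Fin n ⊕ Fin k → ℝ) →L[ℝ] EuclideanSpace ℝ (Fin (n + k))) →ₗ[ℝ] FrameModel n k where
  toFun V := (fun i j => V (Pi.single (Sum.inl j) 1) (Fin.castAdd k i),
    fun A j => V (Pi.single (Sum.inl j) 1) (Fin.natAdd n A),
    fun A B => V (Pi.single (Sum.inr B) 1) (Fin.natAdd n A))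
  map_add' _ _ := rfl
  map_smul' _ _ := rfl

theorem blocks_apply (V : (Fin n ⊕ Fin k → ℝ) →L[ℝ] EuclideanSpace ℝ (Fin (n + k))) :
    blocks V = (fun i j => V (Pi.single (Sum.inl j) 1) (Fin.castAdd k i),
      fun A j => V (Pi.single (Sum.inl j) 1) (Fin.natAdd n A),
      fun A B => V (Pi.single (Sum.inr B) 1) (Fin.natAdd n A)) := rfl

/-- The block lower triangular linear map with given blocks. -/
noncomputable def ofBlocks :
    FrameModel n k →ₗ[ℝ] (Fin n ⊕ Fin k → ℝ) →L[ℝ] EuclideanSpace ℝ (Fin (n + k)) where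
  toFun b := LinearMap.toContinuousLinearMap
    { toFun := fun w => WithLp.toLp 2 (Fin.addCases
        (fun i => ∑ j, b.1 i j * w (Sum.inl j))
        (fun A => ∑ j, b.2.1 A j * w (Sum.inl j) + ∑ B, b.2.2 A B * w (Sum.inr B)))
      map_add' := fun w w' => by
        ext a
        induction a using Fin.addCases <;> simp [mul_add, Finset.sum_add_distrib]
        ring
      map_smul' := fun c w => by
        ext a
        induction a using Fin.addCases <;>
          simp [mul_add, Finset.mul_sum, mul_left_comm] }
  map_add' b b' := by
    ext w a
    induction a using Fin.addCases <;> simp [add_mul, Finset.sum_add_distrib]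
    ring
  map_smul' c b := by
    ext w a
    induction a using Fin.addCases <;> simp [mul_add, Finset.mul_sum, mul_assoc]

theorem ofBlocks_castAdd (b : FrameModel n k) (w : Fin n ⊕ Fin k → ℝ) (i : Fin n) :
    ofBlocks b w (Fin.castAdd k i) = ∑ j, b.1 i j * w (Sum.inl j) := by
  simp [ofBlocks]

theorem ofBlocks_natAdd (b : FrameModel n k) (w : Fin n ⊕ Fin k → ℝ) (A : Fin k) :
    ofBlocks b w (Fin.natAdd n A) =
      ∑ j, b.2.1 A j * w (Sum.inl j) + ∑ B, b.2.2 A B * w (Sum.inr B) := by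
  simp [ofBlocks]

theorem blocks_ofBlocks (b : FrameModel n k) : blocks (ofBlocks b) = b := by
  refine Prod.ext ?_ (Prod.ext ?_ ?_) <;> ext <;>
    simp [blocks_apply, ofBlocks_castAdd, ofBlocks_natAdd, Pi.single_apply]

theorem ofBlocks_single_inr (b : FrameModel n k) (A : Fin k) (i : Fin n) :
    ofBlocks b (Pi.single (Sum.inr A) 1) (Fin.castAdd k i) = 0 := by
  simp [ofBlocks_castAdd]

theorem ofBlocks_blocks {V : (Fin n ⊕ Fin k → ℝ) →L[ℝ] EuclideanSpace ℝ (Fin (n + k))}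
    (hV : ∀ (A : Fin k) (i : Fin n), V (Pi.single (Sum.inr A) 1) (Fin.castAdd k i) = 0) :
    ofBlocks (blocks V) = V := by
  apply ContinuousLinearMap.coe_injective
  refine (Pi.basisFun ℝ (Fin n ⊕ Fin k)).ext fun a => ?_
  ext c
  induction c using Fin.addCases <;> rcases a with a | a <;>
    simp [blocks_apply, ofBlocks_castAdd, ofBlocks_natAdd, Pi.single_apply, hV]

/-- The components of a frame `u` in a chart of `E`. -/
noncomputable def velocity (φ : OpenPartialHomeomorph E (EuclideanSpace ℝ (Fin (n + k))))
    (u : AdaptedFrameBundle hπ) :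
    (Fin n ⊕ Fin k → ℝ) →L[ℝ] EuclideanSpace ℝ (Fin (n + k)) :=
  (chartDeriv φ u.pt).comp
    (u.frameIso : (Fin n ⊕ Fin k → ℝ) →L[ℝ] TangentSpace (𝓡 (n + k)) u.pt)

theorem velocity_single_inr [IsManifold (𝓡 (n + k)) ∞ E] [IsManifold (𝓡 n) ∞ M]
    {φ : OpenPartialHomeomorph E (EuclideanSpace ℝ (Fin (n + k)))}
    (hφ : IsAdaptedChart π φ) (u : AdaptedFrameBundle hπ) (hu : u.pt ∈ φ.source)
    (A : Fin k) (i : Fin n) :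
    velocity φ u (Pi.single (Sum.inr A) 1) (Fin.castAdd k i) = 0 := by
  have h := (hφ.mfderiv_eq_zero_iff hπ hu _).1 (u.vertical A) i
  rw [← frameIso_single] at h
  exact h

/-- The coordinates on `L_π E` induced by an adapted chart of `E`: the coordinates of the base
point, and the components `(v^i_j, v^A_j, v^A_B)` of the frame. -/
noncomputable def coord (φ : OpenPartialHomeomorph E (EuclideanSpace ℝ (Fin (n + k))))
    (u : AdaptedFrameBundle hπ) : EuclideanSpace ℝ (Fin (n + k)) × FrameModel n k :=
  (φ u.pt, blocks (velocity φ u))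

theorem ofBlocks_coord [IsManifold (𝓡 (n + k)) ∞ E] [IsManifold (𝓡 n) ∞ M]
    {φ : OpenPartialHomeomorph E (EuclideanSpace ℝ (Fin (n + k)))}
    (hφ : IsAdaptedChart π φ) (u : AdaptedFrameBundle hπ) (hu : u.pt ∈ φ.source) :
    ofBlocks (coord φ u).2 = velocity φ u :=
  ofBlocks_blocks (velocity_single_inr hφ u hu)

theorem bijOn_coord [IsManifold (𝓡 (n + k)) ∞ E] [IsManifold (𝓡 n) ∞ M]
    {φ : OpenPartialHomeomorph E (EuclideanSpace ℝ (Fin (n + k)))} (hφ : IsAdaptedChart π φ) :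
    Set.BijOn (coord (hπ := hπ) φ) {u | u.pt ∈ φ.source}
      {q | q.1 ∈ φ.target ∧ (ofBlocks q.2).IsInvertible} := by
  refine ⟨?_, ?_, ?_⟩
  · intro u hu
    refine ⟨φ.map_source hu, ?_⟩
    rw [ofBlocks_coord hφ u hu]
    exact ⟨u.frameIso.trans (hφ.mdifferentiable.mfderiv hu), rfl⟩
  · intro u hu u' hu' h
    have h1 : u.pt = u'.pt := φ.injOn hu hu' (congrArg Prod.fst h)
    have h2 : velocity φ u = velocity φ u' := by
      rw [← ofBlocks_coord hφ u hu, ← ofBlocks_coord hφ u' hu', h]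
    obtain ⟨e, b, hb⟩ := u
    obtain ⟨e', b', hb'⟩ := u'
    obtain rfl : e = e' := h1
    congr 1
    apply Module.Basis.eq_of_apply_eq
    intro a
    have h3 := congrArg (fun T => T (Pi.single a 1)) h2
    have h4 := hφ.mdifferentiable.mfderiv_injective hu h3
    exact (frameIso_single _ a).symm.trans (h4.trans (frameIso_single _ a))
  · rintro ⟨z, V⟩ ⟨hz, ℓ, hℓ⟩
    have hz' : z ∈ φ.symm.source := hz
    let D := hφ.mdifferentiable.symm.mfderiv hz'
    let b : Module.Basis (Fin n ⊕ Fin k) ℝ (TangentSpace (𝓡 (n + k)) (φ.symm z)) :=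
      Module.Basis.ofEquivFun (ℓ.toLinearEquiv.trans D.toLinearEquiv).symm
    have hD : ∀ w : EuclideanSpace ℝ (Fin (n + k)), chartDeriv φ (φ.symm z) (D w) = w := fun w =>
      congrArg (fun T => T w) (hφ.mdifferentiable.comp_symm_deriv hz)
    have hb : ∀ a, b a = D (ℓ (Pi.single a 1)) := by
      intro a
      simp [b]
      rfl
    have hmem := φ.map_target hz
    have hvert : ∀ A : Fin k, mfderiv (𝓡 (n + k)) (𝓡 n) π (φ.symm z) (b (Sum.inr A)) = 0 := by
      intro A
      rw [hφ.mfderiv_eq_zero_iff hπ hmem]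
      intro i
      have h5 := ofBlocks_single_inr V A i
      rw [show ofBlocks V = (ℓ : _ →L[ℝ] _) from hℓ.symm] at h5
      rw [hb]
      exact (congrArg (fun w : EuclideanSpace ℝ (Fin (n + k)) => w (Fin.castAdd k i))
        (hD _)).trans h5
    let u : AdaptedFrameBundle hπ := ⟨φ.symm z, b, hvert⟩
    refine ⟨u, hmem, Prod.ext (φ.right_inv hz) ?_⟩
    have h7 : velocity φ u = ofBlocks V := by
      apply ContinuousLinearMap.coe_injective
      refine (Pi.basisFun ℝ (Fin n ⊕ Fin k)).ext fun a => ?_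
      have h6 : velocity φ u (Pi.single a 1) = ofBlocks V (Pi.single a 1) := by
        rw [show ofBlocks V = (ℓ : _ →L[ℝ] _) from hℓ.symm]
        change chartDeriv φ u.pt (u.frameIso (Pi.single a 1)) = _
        rw [frameIso_single]
        change chartDeriv φ (φ.symm z) (b a) = _
        rw [hb]
        exact hD _
      simpa using h6
    change blocks (velocity φ u) = V
    rw [h7, blocks_ofBlocks]

theorem nonempty_of_chart [IsManifold (𝓡 (n + k)) ∞ E] [IsManifold (𝓡 n) ∞ M]
    (hπ : Manifold.IsSubmersion (𝓡 (n + k)) (𝓡 n) ∞ π)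
    (φ : OpenPartialHomeomorph E (EuclideanSpace ℝ (Fin (n + k)))) :
    Nonempty (AdaptedFrameBundle hπ) := by
  obtain ⟨φ', hφ', he⟩ := exists_isAdaptedChart hπ (φ.symm 0)
  let ℓ : (Fin n ⊕ Fin k → ℝ) ≃L[ℝ] EuclideanSpace ℝ (Fin (n + k)) :=
    ((LinearEquiv.funCongrLeft ℝ ℝ finSumFinEquiv.symm).toContinuousLinearEquiv).trans
      (EuclideanSpace.equiv _ ℝ).symm
  have hℓ : ofBlocks (blocks (ℓ : (Fin n ⊕ Fin k → ℝ) →L[ℝ] EuclideanSpace ℝ (Fin (n + k)))) =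
      ℓ := by
    apply ofBlocks_blocks
    intro A i
    simp [ℓ, LinearEquiv.funCongrLeft]
  obtain ⟨u, -⟩ := (bijOn_coord (hπ := hπ) hφ').surjOn
    (show (φ' (φ.symm 0), blocks (ℓ : (Fin n ⊕ Fin k → ℝ) →L[ℝ] _)) ∈ _ from
      ⟨φ'.map_source he, ℓ, hℓ.symm⟩)
  exact ⟨u⟩

/-- The chart of `L_π E` induced by an adapted chart of `E`. -/
noncomputable def frameChart [IsManifold (𝓡 (n + k)) ∞ E] [IsManifold (𝓡 n) ∞ M]
    (hπ : Manifold.IsSubmersion (𝓡 (n + k)) (𝓡 n) ∞ π)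
    {φ : OpenPartialHomeomorph E (EuclideanSpace ℝ (Fin (n + k)))} (hφ : IsAdaptedChart π φ) :
    PartialEquiv (AdaptedFrameBundle hπ)
      (EuclideanSpace ℝ (Fin (n + k)) × FrameModel n k) :=
  haveI := nonempty_of_chart hπ φ
  Set.BijOn.toPartialEquiv (coord φ) _ _ (bijOn_coord hφ)

/-- The transition map between two induced charts is `(z, V) ↦ (τ z, Dτ(z) ∘ V)`, where `τ` is the
transition map of `E`. -/
theorem frameChart_transition [IsManifold (𝓡 (n + k)) ∞ E] [IsManifold (𝓡 n) ∞ M]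
    {φ φ' : OpenPartialHomeomorph E (EuclideanSpace ℝ (Fin (n + k)))} (hφ : IsAdaptedChart π φ)
    (hφ' : IsAdaptedChart π φ')
    {q : EuclideanSpace ℝ (Fin (n + k)) × FrameModel n k}
    (hq : q ∈ ((frameChart hπ hφ).symm.trans (frameChart hπ hφ')).source) :
    ((frameChart hπ hφ).symm.trans (frameChart hπ hφ') q).1 = φ' (φ.symm q.1) ∧
    ((frameChart hπ hφ).symm.trans (frameChart hπ hφ') q).2 =
      blocks ((fderiv ℝ (φ' ∘ φ.symm) q.1).comp (ofBlocks q.2)) := by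
  rw [PartialEquiv.trans_source] at hq
  obtain ⟨hq1, hq2⟩ := hq
  set u := (frameChart hπ hφ).symm q with hu
  have hus : u.pt ∈ φ.source := (frameChart hπ hφ).map_target hq1
  have hus' : u.pt ∈ φ'.source := hq2
  have hr : coord φ u = q := (frameChart hπ hφ).right_inv hq1
  have hr1 : φ u.pt = q.1 := congrArg Prod.fst hr
  have hr2 : velocity φ u = ofBlocks q.2 := by rw [← ofBlocks_coord hφ u hus, hr]
  have hpt : φ.symm q.1 = u.pt := by rw [← hr1, φ.left_inv hus]
  change (coord φ' u).1 = _ ∧ blocks (velocity φ' u) = _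
  refine ⟨by rw [hpt]; rfl, congrArg blocks ?_⟩
  rw [← hr2]
  ext1 w
  have hd : mfderiv (𝓡 (n + k)) (𝓡 (n + k)) (φ' ∘ φ.symm) q.1 =
      (mfderiv (𝓡 (n + k)) (𝓡 (n + k)) φ' (φ.symm q.1)).comp
        (mfderiv (𝓡 (n + k)) (𝓡 (n + k)) φ.symm q.1) :=
    mfderiv_comp q.1 (hφ'.mdifferentiable.mdifferentiableAt (by rwa [hpt]))
      (hφ.mdifferentiable.mdifferentiableAt_symm hq1.1)
  rw [mfderiv_eq_fderiv] at hd
  rw [hd]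
  have hinv := congrArg (fun T => T (u.frameIso w)) (hφ.mdifferentiable.symm_comp_deriv hus)
  rw [hr1] at hinv
  change chartDeriv φ' u.pt (u.frameIso w) = mfderiv (𝓡 (n + k)) (𝓡 (n + k)) φ' (φ.symm q.1)
    (mfderiv (𝓡 (n + k)) (𝓡 (n + k)) φ.symm q.1 (chartDeriv φ u.pt (u.frameIso w)))
  have hinv' : mfderiv (𝓡 (n + k)) (𝓡 (n + k)) φ.symm q.1 (chartDeriv φ u.pt (u.frameIso w)) =
    u.frameIso w := hinv
  rw [hinv', hpt]
  rfl

theorem source_frameChart_transition [IsManifold (𝓡 (n + k)) ∞ E] [IsManifold (𝓡 n) ∞ M]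
    {φ φ' : OpenPartialHomeomorph E (EuclideanSpace ℝ (Fin (n + k)))} (hφ : IsAdaptedChart π φ)
    (hφ' : IsAdaptedChart π φ') :
    ((frameChart hπ hφ).symm.trans (frameChart hπ hφ')).source =
      {q | q.1 ∈ (φ.symm.trans φ').source ∧ (ofBlocks q.2).IsInvertible} := by
  ext q
  rw [PartialEquiv.trans_source]
  have key : q ∈ (frameChart hπ hφ).target →
      ((frameChart hπ hφ).symm q).pt = φ.symm q.1 := by
    intro hq
    have hus : ((frameChart hπ hφ).symm q).pt ∈ φ.source := (frameChart hπ hφ).map_target hq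
    have hr : coord φ ((frameChart hπ hφ).symm q) = q := (frameChart hπ hφ).right_inv hq
    have hr1 : φ ((frameChart hπ hφ).symm q).pt = q.1 := congrArg Prod.fst hr
    rw [← hr1, φ.left_inv hus]
  constructor
  · rintro ⟨h1, h2⟩
    have h2' : ((frameChart hπ hφ).symm q).pt ∈ φ'.source := h2
    rw [key h1] at h2'
    exact ⟨by simpa using ⟨h1.1, h2'⟩, h1.2⟩
  · rintro ⟨h1, h2⟩
    have h3 : q.1 ∈ φ.target ∧ φ.symm q.1 ∈ φ'.source := by simpa using h1
    have h4 : q ∈ (frameChart hπ hφ).target := ⟨h3.1, h2⟩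
    refine ⟨h4, ?_⟩
    change ((frameChart hπ hφ).symm q).pt ∈ φ'.source
    rw [key h4]
    exact h3.2

theorem contDiffOn_frameChart_transition [IsManifold (𝓡 (n + k)) ∞ E] [IsManifold (𝓡 n) ∞ M]
    {φ φ' : OpenPartialHomeomorph E (EuclideanSpace ℝ (Fin (n + k)))} (hφ : IsAdaptedChart π φ)
    (hφ' : IsAdaptedChart π φ') :
    ContDiffOn ℝ ∞ ((frameChart hπ hφ).symm.trans (frameChart hπ hφ'))
      ((frameChart hπ hφ).symm.trans (frameChart hπ hφ')).source := by
  have hopen : IsOpen (φ.symm.trans φ').source := (φ.symm.trans φ').open_source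
  have hτ : ContDiffOn ℝ ∞ (φ' ∘ φ.symm) (φ.symm.trans φ').source := by
    rw [← contMDiffOn_iff_contDiffOn]
    refine (contMDiffOn_of_mem_maximalAtlas hφ'.1).comp
      ((contMDiffOn_symm_of_mem_maximalAtlas hφ.1).mono ?_) ?_
    · intro z hz
      simpa using hz.1
    · intro z hz
      simpa using hz.2
  have hτ' : ContDiffOn ℝ ∞ (fderiv ℝ (φ' ∘ φ.symm)) (φ.symm.trans φ').source :=
    hτ.fderiv_of_isOpen hopen (by simp)
  have hsub : ∀ q ∈ ((frameChart hπ hφ).symm.trans (frameChart hπ hφ')).source,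
      q.1 ∈ (φ.symm.trans φ').source := by
    intro q hq
    rw [source_frameChart_transition] at hq
    exact hq.1
  have hfst : ContDiffOn ℝ ∞
      (Prod.fst : EuclideanSpace ℝ (Fin (n + k)) × FrameModel n k → _)
      ((frameChart hπ hφ).symm.trans (frameChart hπ hφ')).source := contDiff_fst.contDiffOn
  have hsnd : ContDiffOn ℝ ∞
      (fun q : EuclideanSpace ℝ (Fin (n + k)) × FrameModel n k => ofBlocks q.2)
      ((frameChart hπ hφ).symm.trans (frameChart hπ hφ')).source :=
    ((LinearMap.toContinuousLinearMap (ofBlocks (n := n) (k := k))).contDiff.comp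
      contDiff_snd).contDiffOn
  have hmain : ContDiffOn ℝ ∞
      (fun q : EuclideanSpace ℝ (Fin (n + k)) × FrameModel n k =>
        ((φ' ∘ φ.symm) q.1, blocks ((fderiv ℝ (φ' ∘ φ.symm) q.1).comp (ofBlocks q.2))))
      ((frameChart hπ hφ).symm.trans (frameChart hπ hφ')).source :=
    (hτ.comp hfst hsub).prodMk
      ((LinearMap.toContinuousLinearMap (blocks (n := n) (k := k))).contDiff.comp_contDiffOn
        ((hτ'.comp hfst hsub).clm_comp hsnd))
  refine hmain.congr fun q hq => ?_
  obtain ⟨h1, h2⟩ := frameChart_transition hφ hφ' hq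
  exact Prod.ext h1 h2

theorem isOpen_source_frameChart_transition [IsManifold (𝓡 (n + k)) ∞ E] [IsManifold (𝓡 n) ∞ M]
    {φ φ' : OpenPartialHomeomorph E (EuclideanSpace ℝ (Fin (n + k)))} (hφ : IsAdaptedChart π φ)
    (hφ' : IsAdaptedChart π φ') :
    IsOpen ((frameChart hπ hφ).symm.trans (frameChart hπ hφ')).source := by
  rw [source_frameChart_transition]
  exact ((φ.symm.trans φ').open_source.preimage continuous_fst).inter
    (ContinuousLinearEquiv.isOpen.preimage
      ((LinearMap.toContinuousLinearMap (ofBlocks (n := n) (k := k))).continuous.comp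
        continuous_snd))

/-- The atlas of `L_π E` formed by the charts induced by the adapted charts of `E`. -/
noncomputable def chartedSpaceCore [IsManifold (𝓡 (n + k)) ∞ E] [IsManifold (𝓡 n) ∞ M]
    (hπ : Manifold.IsSubmersion (𝓡 (n + k)) (𝓡 n) ∞ π) :
    ChartedSpaceCore (EuclideanSpace ℝ (Fin (n + k)) × FrameModel n k)
      (AdaptedFrameBundle hπ) where
  atlas := {c | ∃ (φ : OpenPartialHomeomorph E (EuclideanSpace ℝ (Fin (n + k))))
    (hφ : IsAdaptedChart π φ), c = frameChart hπ hφ}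
  chartAt u := frameChart hπ (exists_isAdaptedChart hπ u.pt).choose_spec.1
  mem_chart_source u := (exists_isAdaptedChart hπ u.pt).choose_spec.2
  chart_mem_atlas u := ⟨_, _, rfl⟩
  open_source := by
    rintro _ _ ⟨φ, hφ, rfl⟩ ⟨φ', hφ', rfl⟩
    exact isOpen_source_frameChart_transition hφ hφ'
  continuousOn_toFun := by
    rintro _ _ ⟨φ, hφ, rfl⟩ ⟨φ', hφ', rfl⟩
    exact (contDiffOn_frameChart_transition hφ hφ').continuousOn

noncomputable instance [IsManifold (𝓡 (n + k)) ∞ E] [IsManifold (𝓡 n) ∞ M] :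
    TopologicalSpace (AdaptedFrameBundle hπ) :=
  (chartedSpaceCore hπ).toTopologicalSpace

noncomputable instance [IsManifold (𝓡 (n + k)) ∞ E] [IsManifold (𝓡 n) ∞ M] :
    ChartedSpace (EuclideanSpace ℝ (Fin (n + k)) × FrameModel n k) (AdaptedFrameBundle hπ) :=
  (chartedSpaceCore hπ).toChartedSpace

instance [IsManifold (𝓡 (n + k)) ∞ E] [IsManifold (𝓡 n) ∞ M] :
    IsManifold 𝓘(ℝ, EuclideanSpace ℝ (Fin (n + k)) × FrameModel n k) ∞
      (AdaptedFrameBundle hπ) := by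
  apply isManifold_of_contDiffOn
  intro e e' he he'
  obtain ⟨c, hc, rfl⟩ : ∃ c, ∃ h : c ∈ (chartedSpaceCore hπ).atlas,
      e = (chartedSpaceCore hπ).openPartialHomeomorph c h := by
    simpa [atlas, ChartedSpace.atlas, ChartedSpaceCore.toChartedSpace] using he
  obtain ⟨c', hc', rfl⟩ : ∃ c', ∃ h : c' ∈ (chartedSpaceCore hπ).atlas,
      e' = (chartedSpaceCore hπ).openPartialHomeomorph c' h := by
    simpa [atlas, ChartedSpace.atlas, ChartedSpaceCore.toChartedSpace] using he'
  obtain ⟨φ, hφ, rfl⟩ := id hc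
  obtain ⟨φ', hφ', rfl⟩ := id hc'
  exact (contDiffOn_frameChart_transition (hπ := hπ) hφ hφ').mono fun q hq => hq.1

/-! ### The structure group, fundamental vector fields, lifted Lagrangians -/

/-- The right action of an invertible block lower triangular matrix `g` on adapted frames:
`(u · g)_β = ∑ α, g_{αβ} u_α`. -/
noncomputable def act (u : AdaptedFrameBundle hπ) (g : Matrix (Fin n ⊕ Fin k) (Fin n ⊕ Fin k) ℝ)
    (hg : IsUnit g.det) (hg' : ∀ (i : Fin n) (A : Fin k), g (Sum.inl i) (Sum.inr A) = 0) :
    AdaptedFrameBundle hπ where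
  pt := u.pt
  frame := u.frame.map (Matrix.toLinearEquiv u.frame g hg)
  vertical A := by
    have h : (u.frame.map (Matrix.toLinearEquiv u.frame g hg)) (Sum.inr A) =
        ∑ B, g (Sum.inr B) (Sum.inr A) • u.frame (Sum.inr B) := by
      simp [Matrix.toLinearEquiv, Matrix.toLin_self, hg']
    rw [h, map_sum]
    exact Finset.sum_eq_zero fun B _ => by rw [map_smul, u.vertical B, smul_zero]

theorem exp_lower {ξ : Matrix (Fin n ⊕ Fin k) (Fin n ⊕ Fin k) ℝ}
    (hξ : ∀ (i : Fin n) (A : Fin k), ξ (Sum.inl i) (Sum.inr A) = 0) (t : ℝ)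
    (i : Fin n) (A : Fin k) :
    NormedSpace.exp (t • ξ) (Sum.inl i) (Sum.inr A) = 0 := by
  have h : (t • ξ).BlockTriangular (Sum.elim (fun _ : Fin n => (1 : ℕ)) (fun _ : Fin k => 0)) := by
    rintro (a | a) (b | b) hab <;> simp_all
  exact h.exp (by simp)

theorem isUnit_det_exp (ξ : Matrix (Fin n ⊕ Fin k) (Fin n ⊕ Fin k) ℝ) :
    IsUnit (NormedSpace.exp ξ).det :=
  (Matrix.isUnit_iff_isUnit_det _).1 (Matrix.isUnit_exp ξ)

/-- `ξ^*(L)(u)`: the derivative of the function `L` along the fundamental vertical vector field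
`ξ^*(u) = d/dt|_{t=0} u · exp (t ξ)` of an element `ξ` of the Lie algebra of block lower triangular
matrices. -/
noncomputable def fundamentalDeriv (ξ : Matrix (Fin n ⊕ Fin k) (Fin n ⊕ Fin k) ℝ)
    (hξ : ∀ (i : Fin n) (A : Fin k), ξ (Sum.inl i) (Sum.inr A) = 0)
    (L : AdaptedFrameBundle hπ → ℝ) (u : AdaptedFrameBundle hπ) : ℝ :=
  deriv (fun t : ℝ => L (u.act (NormedSpace.exp (t • ξ)) (isUnit_det_exp _) (exp_lower hξ t))) 0

/-- `E^{*i}_j(L)`. The matrix `E^i_j` has its single entry `1` in row `j` and column `i`, so that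
`E^{*i}_j` moves `e_i` in the direction `e_j`. -/
noncomputable def horizontalDeriv (i j : Fin n) (L : AdaptedFrameBundle hπ → ℝ) :
    AdaptedFrameBundle hπ → ℝ :=
  fundamentalDeriv (Matrix.single (Sum.inl j) (Sum.inl i) 1) (by simp) L

/-- `E^{*A}_B(L)`: the field `E^{*A}_B` moves `e_A` in the direction `e_B`. -/
noncomputable def verticalDeriv (A B : Fin k) (L : AdaptedFrameBundle hπ → ℝ) :
    AdaptedFrameBundle hπ → ℝ :=
  fundamentalDeriv (Matrix.single (Sum.inr B) (Sum.inr A) 1) (by simp) L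

/-- The covariant momenta `E^{*i}_A(L)`: the field `E^{*i}_A` moves `e_i` in the direction
`e_A`. -/
noncomputable def momentum (i : Fin n) (A : Fin k) (L : AdaptedFrameBundle hπ → ℝ) :
    AdaptedFrameBundle hπ → ℝ :=
  fundamentalDeriv (Matrix.single (Sum.inr A) (Sum.inl i) 1) (by simp) L

/-- A (smooth) lifted Lagrangian on `L_π E`. -/
structure IsLiftedLagrangian [IsManifold (𝓡 (n + k)) ∞ E] [IsManifold (𝓡 n) ∞ M]
    (L : AdaptedFrameBundle hπ → ℝ) : Prop where
  smooth : ContMDiff 𝓘(ℝ, EuclideanSpace ℝ (Fin (n + k)) × FrameModel n k) 𝓘(ℝ, ℝ) ∞ L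
  horizontalDeriv_eq_zero : ∀ i j u, horizontalDeriv i j L u = 0
  verticalDeriv_eq_zero : ∀ A B u, verticalDeriv A B L u = 0

/-! ### The soldering form and the Cartan-Hamilton-Poincaré forms -/

section

variable [IsManifold (𝓡 (n + k)) ∞ E] [IsManifold (𝓡 n) ∞ M]

/-- The `ℝ^{n+k}`-valued soldering form `θ = (θ^i, θ^A)`: the components with respect to the frame
`u` of the projection of a tangent vector to `E`. -/
noncomputable def soldering (u : AdaptedFrameBundle hπ) :
    TangentSpace 𝓘(ℝ, EuclideanSpace ℝ (Fin (n + k)) × FrameModel n k) u →L[ℝ]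
      (Fin n ⊕ Fin k → ℝ) :=
  (u.frameIso.symm : TangentSpace (𝓡 (n + k)) u.pt →L[ℝ] (Fin n ⊕ Fin k → ℝ)).comp
    (mfderiv 𝓘(ℝ, EuclideanSpace ℝ (Fin (n + k)) × FrameModel n k) (𝓡 (n + k))
      (AdaptedFrameBundle.pt : AdaptedFrameBundle hπ → E) u)

/-- The Cartan-Hamilton-Poincaré `1`-forms
`θ^i_L = τ L θ^i + ∑ A, E^{*i}_A(L) θ^A` and `θ^A_L = θ^A`,
combined to an `ℝ^{n+k}`-valued `1`-form. -/
noncomputable def chpForm (τ : ℝ) (L : AdaptedFrameBundle hπ → ℝ) (u : AdaptedFrameBundle hπ) :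
    TangentSpace 𝓘(ℝ, EuclideanSpace ℝ (Fin (n + k)) × FrameModel n k) u →L[ℝ]
      (Fin n ⊕ Fin k → ℝ) :=
  ContinuousLinearMap.pi (Sum.elim
    (fun i => (τ * L u) • (ContinuousLinearMap.proj (Sum.inl i)).comp (soldering u) +
      ∑ A, momentum i A L u • (ContinuousLinearMap.proj (Sum.inr A)).comp (soldering u))
    (fun A => (ContinuousLinearMap.proj (Sum.inr A)).comp (soldering u)))

end

end AdaptedFrameBundle

end

/-! In a chart of `L_π E` induced by an adapted chart of `E`, a point is a pair (z, V) with V an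
invertible block lower triangular matrix. The soldering form is V⁻¹ dz, a lifted Lagrangian becomes
a function ℓ(z, V), and the fundamental field of ξ is (0, Vξ). The momenta are thus first
derivatives of ℓ along fields linear in V, so the forms θ_L are smooth. Smoothness and closedness of
dθ_L then follow from the exterior calculus of the model space: `extDeriv` commutes with pull-back
along transition maps, so d can be computed in any chart (`inChart_d`), and d ∘ d = 0 there.

Non-degeneracy is pointwise linear algebra (`eq_zero_of_annihilates`), based on d(V⁻¹) = -V⁻¹ dV V⁻¹
(`fderiv_coframe_apply`). Let X = (X₁, X₂) annihilate dθ_L and put x = V⁻¹X₁. Testing dθ^A against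
the vertical directions Vξ, where row A of ξ is arbitrary, gives x = 0. If k = 0 there is no θ^A;
then dθ^i_L is tested against the fields E^{*j}_j, along which L has derivative zero, and τL ≠ 0
again gives x = 0.

So X is vertical, X₂ = VΩ with Ω block lower triangular. Testing dθ^A against the vectors (V e_β, 0)
shows that the rows A of Ω vanish, and Ω is supported in the block gl(n). There X is a combination
of the fields E^{*i}_j, so dℓ(X) = 0. Testing dθ^i_L against (V e_j, 0) now leaves τ L Ω^i_j = 0,
the momentum terms having dropped out. Hence Ω = 0 and X = 0. -/

namespace ManifoldForm

/-! ### Exterior calculus on a manifold through its charts -/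

section

variable {F : Type*} [NormedAddCommGroup F] [NormedSpace ℝ F]
  {P : Type*} [TopologicalSpace P] [ChartedSpace F P]
  {W : Type*} [NormedAddCommGroup W] [NormedSpace ℝ W] {p : ℕ}

theorem minSmoothness_two_le_infty : minSmoothness ℝ 2 ≤ ∞ := by
  rw [minSmoothness_of_isRCLikeNormedField]
  exact WithTop.coe_le_coe.2 le_top

theorem mdifferentiable_of_mem_atlas [IsManifold 𝓘(ℝ, F) ∞ P]
    {φ : OpenPartialHomeomorph P F} (hφ : φ ∈ atlas F P) :
    φ.MDifferentiable 𝓘(ℝ, F) 𝓘(ℝ, F) :=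
  ⟨(contMDiffOn_of_mem_maximalAtlas (n := ∞)
      (IsManifold.subset_maximalAtlas hφ)).mdifferentiableOn (by simp),
    (contMDiffOn_symm_of_mem_maximalAtlas (n := ∞)
      (IsManifold.subset_maximalAtlas hφ)).mdifferentiableOn (by simp)⟩

theorem contDiffOn_transition [IsManifold 𝓘(ℝ, F) ∞ P]
    {φ ψ : OpenPartialHomeomorph P F} (hφ : φ ∈ atlas F P) (hψ : ψ ∈ atlas F P) :
    ContDiffOn ℝ ∞ (ψ ∘ φ.symm) (φ.symm.trans ψ).source := by
  rw [← contMDiffOn_iff_contDiffOn]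
  refine (contMDiffOn_of_mem_maximalAtlas (n := ∞) (IsManifold.subset_maximalAtlas hψ)).comp
    ((contMDiffOn_symm_of_mem_maximalAtlas (n := ∞)
      (IsManifold.subset_maximalAtlas hφ)).mono ?_) ?_
  · intro z hz
    simpa using hz.1
  · intro z hz
    simpa using hz.2

theorem fderiv_transition [IsManifold 𝓘(ℝ, F) ∞ P]
    {φ ψ : OpenPartialHomeomorph P F} (hφ : φ ∈ atlas F P) (hψ : ψ ∈ atlas F P)
    {z : F} (hz : z ∈ φ.target) (hz' : φ.symm z ∈ ψ.source) :
    fderiv ℝ (ψ ∘ φ.symm) z =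
      (mfderiv 𝓘(ℝ, F) 𝓘(ℝ, F) ψ (φ.symm z)).comp (mfderiv 𝓘(ℝ, F) 𝓘(ℝ, F) φ.symm z) := by
  rw [← mfderiv_eq_fderiv]
  exact mfderiv_comp z ((mdifferentiable_of_mem_atlas hψ).mdifferentiableAt hz')
    ((mdifferentiable_of_mem_atlas hφ).mdifferentiableAt_symm hz)

/-- A form is recovered from its local representative in a chart. -/
theorem inChart_compContinuousLinearMap [IsManifold 𝓘(ℝ, F) ∞ P]
    (α : ∀ u : P, TangentSpace 𝓘(ℝ, F) u [⋀^Fin p]→L[ℝ] W)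
    {φ : OpenPartialHomeomorph P F} (hφ : φ ∈ atlas F P) {u : P} (hu : u ∈ φ.source) :
    (inChart α φ (φ u)).compContinuousLinearMap
      (mfderiv 𝓘(ℝ, F) 𝓘(ℝ, F) φ u : TangentSpace 𝓘(ℝ, F) u →L[ℝ] F) = α u := by
  -- The equality `φ.symm (φ u) = u` cannot be rewritten directly, since the type of `α` depends on
  -- the point. Every tangent space is the model space `F` by definition, so the transport is done
  -- with all forms read on `F`.
  have key : ∀ q : P, q = u → ∀ A : F →L[ℝ] F,
      (show F [⋀^Fin p]→L[ℝ] W from α q).compContinuousLinearMap A =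
        (show F [⋀^Fin p]→L[ℝ] W from α u).compContinuousLinearMap A := by
    rintro _ rfl A
    rfl
  have h1 : inChart α φ (φ u) = (show F [⋀^Fin p]→L[ℝ] W from α u).compContinuousLinearMap
      (mfderiv 𝓘(ℝ, F) 𝓘(ℝ, F) φ.symm (φ u) : F →L[ℝ] F) := key _ (φ.left_inv hu) _
  have h2 := (mdifferentiable_of_mem_atlas hφ).symm_comp_deriv hu
  rw [h1]
  ext v
  have h3 : ∀ X : F, (mfderiv 𝓘(ℝ, F) 𝓘(ℝ, F) φ.symm (φ u) : F →L[ℝ] F)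
      ((mfderiv 𝓘(ℝ, F) 𝓘(ℝ, F) φ u : F →L[ℝ] F) X) = X := fun X => congrArg (fun T => T X) h2
  exact congrArg (show F [⋀^Fin p]→L[ℝ] W from α u) (funext fun i => h3 (v i))

/-- The transformation of local representatives under a change of charts. -/
theorem inChart_eq_pullback [IsManifold 𝓘(ℝ, F) ∞ P]
    (α : ∀ u : P, TangentSpace 𝓘(ℝ, F) u [⋀^Fin p]→L[ℝ] W)
    {φ ψ : OpenPartialHomeomorph P F} (hφ : φ ∈ atlas F P) (hψ : ψ ∈ atlas F P)
    {z : F} (hz : z ∈ φ.target) (hz' : φ.symm z ∈ ψ.source) :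
    inChart α φ z = (inChart α ψ ((ψ ∘ φ.symm) z)).compContinuousLinearMap
      (fderiv ℝ (ψ ∘ φ.symm) z) := by
  rw [fderiv_transition hφ hψ hz hz', inChart, ← inChart_compContinuousLinearMap α hψ hz']
  rfl

theorem IsSmooth.contDiffAt {α : ∀ u : P, TangentSpace 𝓘(ℝ, F) u [⋀^Fin p]→L[ℝ] W}
    (hα : IsSmooth α) {φ : OpenPartialHomeomorph P F} (hφ : φ ∈ atlas F P) {z : F}
    (hz : z ∈ φ.target) : ContDiffAt ℝ ∞ (inChart α φ) z :=
  (hα φ hφ).contDiffAt (φ.open_target.mem_nhds hz)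

/-- The exterior derivative may be computed in any chart of the atlas. -/
theorem inChart_d [IsManifold 𝓘(ℝ, F) ∞ P]
    {α : ∀ u : P, TangentSpace 𝓘(ℝ, F) u [⋀^Fin p]→L[ℝ] W} (hα : IsSmooth α)
    {φ : OpenPartialHomeomorph P F} (hφ : φ ∈ atlas F P) {z : F} (hz : z ∈ φ.target) :
    inChart (d α) φ z = extDeriv (inChart α φ) z := by
  have hψ := chart_mem_atlas F (φ.symm z)
  have hz' := mem_chart_source F (φ.symm z)
  set ψ := chartAt F (φ.symm z) with hψdef
  have hsrc : z ∈ (φ.symm.trans ψ).source := by simpa using ⟨hz, hz'⟩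
  have hnhds : (φ.symm.trans ψ).source ∈ 𝓝 z := (φ.symm.trans ψ).open_source.mem_nhds hsrc
  have hev : inChart α φ =ᶠ[𝓝 z] fun x =>
      (inChart α ψ ((ψ ∘ φ.symm) x)).compContinuousLinearMap (fderiv ℝ (ψ ∘ φ.symm) x) := by
    filter_upwards [hnhds] with x hx
    have hx' : x ∈ φ.target ∧ φ.symm x ∈ ψ.source := by simpa using hx
    exact inChart_eq_pullback α hφ hψ hx'.1 hx'.2
  have hdiff : DifferentiableAt ℝ (inChart α ψ) ((ψ ∘ φ.symm) z) :=
    (hα.contDiffAt hψ (ψ.map_source hz')).differentiableAt (by simp)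
  -- Naturality of `extDeriv` under the transition map; the derivative of that map then factors as
  -- the two tangent maps in the definitions of `d` and `inChart`.
  rw [hev.extDeriv_eq, extDeriv_pullback hdiff ((contDiffOn_transition hφ hψ).contDiffAt hnhds)
    minSmoothness_two_le_infty, fderiv_transition hφ hψ hz hz']
  rfl

/-- The exterior derivative of a smooth form is smooth. -/
theorem IsSmooth.d [IsManifold 𝓘(ℝ, F) ∞ P]
    {α : ∀ u : P, TangentSpace 𝓘(ℝ, F) u [⋀^Fin p]→L[ℝ] W} (hα : IsSmooth α) :
    IsSmooth (d α) := by
  intro φ hφ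
  have h : ContDiffOn ℝ ∞ (extDeriv (inChart α φ)) φ.target :=
    (ContinuousAlternatingMap.alternatizeUncurryFinCLM ℝ F W).contDiff.comp_contDiffOn
      ((hα φ hφ).fderiv_of_isOpen φ.open_target (by simp))
  exact h.congr fun z hz => inChart_d hα hφ hz

/-- `d ∘ d = 0`. -/
theorem IsSmooth.d_d [IsManifold 𝓘(ℝ, F) ∞ P]
    {α : ∀ u : P, TangentSpace 𝓘(ℝ, F) u [⋀^Fin p]→L[ℝ] W} (hα : IsSmooth α) (u : P) :
    ManifoldForm.d (ManifoldForm.d α) u = 0 := by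
  have hφ := chart_mem_atlas F u
  have hz := (chartAt F u).map_source (mem_chart_source F u)
  have hev : inChart (ManifoldForm.d α) (chartAt F u) =ᶠ[𝓝 (chartAt F u u)]
      extDeriv (inChart α (chartAt F u)) := by
    filter_upwards [(chartAt F u).open_target.mem_nhds hz] with x hx
    exact inChart_d hα hφ hx
  rw [ManifoldForm.d, hev.extDeriv_eq,
    extDeriv_extDeriv_apply (hα.contDiffAt hφ hz) minSmoothness_two_le_infty]
  rfl

/-- Non-degeneracy of `dα` may be checked on the local representatives. -/
theorem d_nondegenerate [IsManifold 𝓘(ℝ, F) ∞ P]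
    {α : ∀ u : P, TangentSpace 𝓘(ℝ, F) u [⋀^Fin 1]→L[ℝ] W}
    (h : ∀ φ ∈ atlas F P, ∀ z ∈ φ.target, ∀ X : F,
      (∀ Y : F, extDeriv (inChart α φ) z ![X, Y] = 0) → X = 0)
    (u : P) (X : TangentSpace 𝓘(ℝ, F) u) :
    (∀ Y : TangentSpace 𝓘(ℝ, F) u, ManifoldForm.d α u ![X, Y] = 0) ↔ X = 0 := by
  have hu := mem_chart_source F u
  let D := (mdifferentiable_of_mem_atlas (chart_mem_atlas F u)).mfderiv hu
  have hD : ∀ Y, ManifoldForm.d α u ![X, Y] =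
      extDeriv (inChart α (chartAt F u)) (chartAt F u u) ![D X, D Y] := by
    intro Y
    refine congrArg (extDeriv (inChart α (chartAt F u)) (chartAt F u u)) (funext fun i => ?_)
    fin_cases i <;> rfl
  constructor
  · intro hX
    apply D.injective
    rw [map_zero]
    refine h _ (chart_mem_atlas F u) _ ((chartAt F u).map_source hu) _ fun Y => ?_
    have h1 := hX (D.symm Y)
    rw [hD] at h1
    exact (congrArg (fun Z : F => extDeriv (inChart α (chartAt F u)) (chartAt F u u)
      ![(D X : F), Z]) (D.apply_symm_apply Y)).symm.trans h1
  · rintro rfl Y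
    exact (ManifoldForm.d α u).map_coord_zero 0 rfl

end

end ManifoldForm

/-! ### Linear algebra of block lower triangular frames -/

namespace AdaptedFrameBundle

section

variable {n k : ℕ}

/-- The endomorphism of `ℝ^{n+k}` given by a matrix. -/
noncomputable def matrixCLM :
    Matrix (Fin n ⊕ Fin k) (Fin n ⊕ Fin k) ℝ →ₗ[ℝ] (Fin n ⊕ Fin k → ℝ) →L[ℝ] (Fin n ⊕ Fin k → ℝ) :=
  LinearMap.toContinuousLinearMap.toLinearMap ∘ₗ Matrix.toLin'.toLinearMap

theorem matrixCLM_apply (ξ : Matrix (Fin n ⊕ Fin k) (Fin n ⊕ Fin k) ℝ) (w : Fin n ⊕ Fin k → ℝ) :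
    matrixCLM ξ w = ξ.mulVec w := rfl

/-- The coordinate expression of the fundamental vertical vector fields: the blocks of `V ξ`. -/
noncomputable def verticalDir (b : FrameModel n k) :
    Matrix (Fin n ⊕ Fin k) (Fin n ⊕ Fin k) ℝ →ₗ[ℝ] FrameModel n k where
  toFun ξ := blocks ((ofBlocks b).comp (matrixCLM ξ))
  map_add' ξ η := by rw [map_add, ContinuousLinearMap.comp_add, map_add]
  map_smul' c ξ := by rw [map_smul, ContinuousLinearMap.comp_smul, map_smul, RingHom.id_apply]

theorem verticalDir_apply (b : FrameModel n k) (ξ : Matrix (Fin n ⊕ Fin k) (Fin n ⊕ Fin k) ℝ) :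
    verticalDir b ξ = blocks ((ofBlocks b).comp (matrixCLM ξ)) := rfl

/-- A product of block lower triangular matrices is again of this kind, so passing to its three
blocks loses nothing. -/
theorem ofBlocks_verticalDir (b : FrameModel n k) {ξ : Matrix (Fin n ⊕ Fin k) (Fin n ⊕ Fin k) ℝ}
    (hξ : ∀ (i : Fin n) (A : Fin k), ξ (Sum.inl i) (Sum.inr A) = 0) :
    ofBlocks (verticalDir b ξ) = (ofBlocks b).comp (matrixCLM ξ) := by
  refine ofBlocks_blocks fun A i => ?_
  rw [ContinuousLinearMap.comp_apply, ofBlocks_castAdd, matrixCLM_apply, Matrix.mulVec_single_one]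
  exact Finset.sum_eq_zero fun j _ => by rw [Matrix.col_apply, hξ, mul_zero]

/-- If a block lower triangular map is invertible, it reflects verticality. -/
theorem eq_zero_of_ofBlocks_castAdd_eq_zero {b : FrameModel n k}
    (hb : (ofBlocks b).IsInvertible) {w : Fin n ⊕ Fin k → ℝ}
    (hw : ∀ i : Fin n, ofBlocks b w (Fin.castAdd k i) = 0) (i : Fin n) : w (Sum.inl i) = 0 := by
  obtain ⟨e, he⟩ := hb
  let T : (Fin n → ℝ) →ₗ[ℝ] (Fin n → ℝ) := Matrix.toLin' (b.1 : Matrix (Fin n) (Fin n) ℝ)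
  have hT : ∀ (v : Fin n ⊕ Fin k → ℝ) (i : Fin n),
      T (fun j => v (Sum.inl j)) i = ofBlocks b v (Fin.castAdd k i) := fun v i => by
    rw [ofBlocks_castAdd]
    rfl
  -- The horizontal part of V w depends only on the horizontal part of w, through the upper left
  -- block `T`. Padding a horizontal vector by zeros and applying V⁻¹ gives a preimage; a surjective
  -- square block is injective.
  have hsurj : Function.Surjective T := by
    intro z
    refine ⟨fun j => e.symm (WithLp.toLp 2 (Fin.addCases z (fun _ => 0))) (Sum.inl j), ?_⟩
    ext i
    rw [hT, ← he]
    simp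
  have h0 : T (fun j => w (Sum.inl j)) = T 0 := by
    ext i
    rw [hT, hw, map_zero, Pi.zero_apply]
  exact congrFun (LinearMap.injective_iff_surjective.2 hsurj h0) i

/-- The pointwise linear algebra behind non-degeneracy: the hypotheses `hA` and `hi` say that
`X` annihilates the exterior derivatives of `θ^A` and of `θ^i_L`. -/
theorem eq_zero_of_annihilates (hm : 1 ≤ n + k) {b : FrameModel n k}
    {e : (Fin n ⊕ Fin k → ℝ) ≃L[ℝ] EuclideanSpace ℝ (Fin (n + k))}
    (he : (e : (Fin n ⊕ Fin k → ℝ) →L[ℝ] EuclideanSpace ℝ (Fin (n + k))) = ofBlocks b)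
    {τ c : ℝ} (hτ : τ ≠ 0) (hc : c ≠ 0)
    (dℓ : EuclideanSpace ℝ (Fin (n + k)) × FrameModel n k →L[ℝ] ℝ)
    (hh : ∀ i j, dℓ (0, verticalDir b (Matrix.single (Sum.inl j) (Sum.inl i) 1)) = 0)
    (p : Fin n → Fin k → ℝ)
    (dp : Fin n → Fin k → EuclideanSpace ℝ (Fin (n + k)) × FrameModel n k →L[ℝ] ℝ)
    {X : EuclideanSpace ℝ (Fin (n + k)) × FrameModel n k}
    (hA : ∀ (Y : EuclideanSpace ℝ (Fin (n + k)) × FrameModel n k) (A : Fin k),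
      e.symm (ofBlocks X.2 (e.symm Y.1)) (Sum.inr A) =
        e.symm (ofBlocks Y.2 (e.symm X.1)) (Sum.inr A))
    (hi : ∀ (Y : EuclideanSpace ℝ (Fin (n + k)) × FrameModel n k) (i : Fin n),
      τ * (dℓ X * e.symm Y.1 (Sum.inl i) - c * e.symm (ofBlocks X.2 (e.symm Y.1)) (Sum.inl i)) +
        ∑ A, (dp i A X * e.symm Y.1 (Sum.inr A) -
          p i A * e.symm (ofBlocks X.2 (e.symm Y.1)) (Sum.inr A)) =
      τ * (dℓ Y * e.symm X.1 (Sum.inl i) - c * e.symm (ofBlocks Y.2 (e.symm X.1)) (Sum.inl i)) +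
        ∑ A, (dp i A Y * e.symm X.1 (Sum.inr A) -
          p i A * e.symm (ofBlocks Y.2 (e.symm X.1)) (Sum.inr A))) :
    X = 0 := by
  have hvert : ∀ ξ : Matrix (Fin n ⊕ Fin k) (Fin n ⊕ Fin k) ℝ,
      (∀ (i : Fin n) (A : Fin k), ξ (Sum.inl i) (Sum.inr A) = 0) → ∀ w,
      e.symm (ofBlocks (verticalDir b ξ) w) = ξ.mulVec w := by
    intro ξ hξ w
    rw [ofBlocks_verticalDir b hξ, ← he]
    simp [matrixCLM_apply]
  have hx : e.symm X.1 = 0 := by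
    -- For k = 0 the vertical direction E_jj in the j-th form yields τ c x_j = 0. For k > 0 any
    -- single index A suffices: the matrix unit in row A and column a is lower triangular for every
    -- a, and the A-th form returns x_a.
    rcases Nat.eq_zero_or_pos k with rfl | hk
    · ext (j | A)
      · have h1 := hi (0, verticalDir b (Matrix.single (Sum.inl j) (Sum.inl j) 1)) j
        rw [hvert _ (by simp), hh] at h1
        simpa [Matrix.single_mulVec, hτ, hc] using h1
      · exact A.elim0
    · ext a
      have h1 := hA (0, verticalDir b (Matrix.single (Sum.inr ⟨0, hk⟩) a 1)) ⟨0, hk⟩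
      rw [hvert _ (by simp)] at h1
      simpa [Matrix.single_mulVec] using h1.symm
  simp only [hx, map_zero, Pi.zero_apply, mul_zero, sub_zero, Finset.sum_const_zero, add_zero]
    at hA hi
  -- Ω = V⁻¹X₂ is the Lie algebra element whose fundamental field has the value X, since X₁ = 0.
  let Ω : Matrix (Fin n ⊕ Fin k) (Fin n ⊕ Fin k) ℝ :=
    fun a β => e.symm (ofBlocks X.2 (Pi.single β 1)) a
  have hΩr : ∀ (A : Fin k) β, Ω (Sum.inr A) β = 0 := by
    intro A β
    have h1 := hA (e (Pi.single β 1), 0) A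
    simpa using h1
  have hΩl : ∀ (i : Fin n) (A : Fin k), Ω (Sum.inl i) (Sum.inr A) = 0 := by
    intro i A
    -- V maps column A of Ω to a column of X₂ without horizontal part, and V reflects verticality.
    refine eq_zero_of_ofBlocks_castAdd_eq_zero (b := b) ⟨e, he⟩ (fun j => ?_) i
    rw [← he]
    simp [ofBlocks_single_inr]
  have hΩ : X.2 = verticalDir b Ω := by
    rw [verticalDir_apply, ← blocks_ofBlocks X.2, ← he]
    congr 1
    apply ContinuousLinearMap.coe_injective
    refine (Pi.basisFun ℝ (Fin n ⊕ Fin k)).ext fun a => ?_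
    have h1 : matrixCLM Ω (Pi.single a 1) = e.symm (ofBlocks X.2 (Pi.single a 1)) := by
      rw [matrixCLM_apply, Matrix.mulVec_single_one]
      rfl
    simp [h1]
  have hX1 : X.1 = 0 := by
    rw [← e.apply_symm_apply X.1, hx, map_zero]
  have hΩsum : Ω = ∑ i, ∑ j, Ω (Sum.inl i) (Sum.inl j) •
      Matrix.single (Sum.inl i) (Sum.inl j) (1 : ℝ) := by
    ext (i | A) (j | B)
    · simp [Matrix.sum_apply, Matrix.single_apply, ite_and]
    · simp [Matrix.sum_apply, hΩl]
    · simp [Matrix.sum_apply, hΩr]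
    · simp [Matrix.sum_apply, hΩr]
  have hdX : dℓ X = 0 := by
    let f : Matrix (Fin n ⊕ Fin k) (Fin n ⊕ Fin k) ℝ →ₗ[ℝ] ℝ :=
      dℓ.toLinearMap ∘ₗ LinearMap.inr ℝ _ _ ∘ₗ verticalDir b
    have h1 : dℓ X = f Ω := congrArg dℓ (Prod.ext hX1 hΩ)
    rw [h1, hΩsum, map_sum]
    refine Finset.sum_eq_zero fun i _ => ?_
    rw [map_sum]
    refine Finset.sum_eq_zero fun j _ => ?_
    rw [map_smul, show f _ = 0 from hh j i, smul_zero]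
  have hΩ0 : Ω = 0 := by
    ext (i | A) (j | B)
    -- For this Y the vertical components of V⁻¹Y₁ vanish, and so do the rows A of Ω; both momentum
    -- sums disappear.
    · have h1 := hi (e (Pi.single (Sum.inl j) 1), 0) i
      have h2 : ∀ A, e.symm (ofBlocks X.2 (Pi.single (Sum.inl j) 1)) (Sum.inr A) = 0 :=
        fun A => hΩr A _
      simpa [hdX, h2, hτ, hc] using h1
    · exact hΩl i B
    · exact hΩr A _
    · exact hΩr A _
  refine Prod.ext hX1 ?_
  rw [hΩ, hΩ0, map_zero]
  rfl

/-! ### The inverse frame matrix and its derivative -/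

/-- The inverse of the matrix of frame components. -/
noncomputable def coframe (q : EuclideanSpace ℝ (Fin (n + k)) × FrameModel n k) :
    EuclideanSpace ℝ (Fin (n + k)) →L[ℝ] (Fin n ⊕ Fin k → ℝ) :=
  (ofBlocks q.2).inverse

theorem contDiff_ofBlocks_snd : ContDiff ℝ ∞
    (fun q : EuclideanSpace ℝ (Fin (n + k)) × FrameModel n k => ofBlocks q.2) :=
  (LinearMap.toContinuousLinearMap (ofBlocks (n := n) (k := k))).contDiff.comp contDiff_snd

/-- Inversion is smooth at invertible maps. Elsewhere `ContinuousLinearMap.inverse` takes the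
default value 0, so the statement is local. -/
theorem contDiffAt_coframe {q : EuclideanSpace ℝ (Fin (n + k)) × FrameModel n k}
    (hq : (ofBlocks q.2).IsInvertible) : ContDiffAt ℝ ∞ coframe q := by
  obtain ⟨e, he⟩ := hq
  have h := contDiffAt_map_inverse (𝕜 := ℝ) (n := ∞) e
  rw [he] at h
  exact h.comp q contDiff_ofBlocks_snd.contDiffAt

/-- Differentiate V(V⁻¹y) = y with y fixed and solve for the derivative of V⁻¹y. -/
theorem fderiv_coframe_apply {q : EuclideanSpace ℝ (Fin (n + k)) × FrameModel n k}
    (hq : (ofBlocks q.2).IsInvertible) (y : EuclideanSpace ℝ (Fin (n + k)))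
    (X : EuclideanSpace ℝ (Fin (n + k)) × FrameModel n k) :
    fderiv ℝ (fun q' => coframe q' y) q X = -coframe q (ofBlocks X.2 (coframe q y)) := by
  have hS : DifferentiableAt ℝ (fun q' => coframe q' y) q :=
    ((contDiffAt_coframe hq).differentiableAt (by simp)).clm_apply (differentiableAt_const y)
  have hT : HasFDerivAt
      (fun q : EuclideanSpace ℝ (Fin (n + k)) × FrameModel n k => ofBlocks q.2)
      ((LinearMap.toContinuousLinearMap (ofBlocks (n := n) (k := k))).comp
        (ContinuousLinearMap.snd ℝ _ _)) q :=
    (LinearMap.toContinuousLinearMap (ofBlocks (n := n) (k := k))).hasFDerivAt.comp q hasFDerivAt_snd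
  have hprod := hT.clm_apply hS.hasFDerivAt
  have hopen : ∀ᶠ q' : EuclideanSpace ℝ (Fin (n + k)) × FrameModel n k in 𝓝 q,
      (ofBlocks q'.2).IsInvertible :=
    contDiff_ofBlocks_snd.continuous.continuousAt.eventually_mem
      (ContinuousLinearEquiv.isOpen.mem_nhds hq)
  -- The identity is needed on a neighbourhood of `q`, which is available because the invertible
  -- maps form an open set.
  have hconst : (fun q' : EuclideanSpace ℝ (Fin (n + k)) × FrameModel n k =>
      ofBlocks q'.2 (coframe q' y)) =ᶠ[𝓝 q] fun _ => y := by
    filter_upwards [hopen] with q' hq'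
    exact hq'.self_apply_inverse y
  have h0 := (hprod.congr_of_eventuallyEq hconst.symm).unique (hasFDerivAt_const y q)
  have h1 := congrArg (fun T => coframe q (T X)) h0
  have h2 : coframe q (ofBlocks q.2 (fderiv ℝ (fun q' => coframe q' y) q X)) =
      fderiv ℝ (fun q' => coframe q' y) q X := hq.inverse_apply_self _
  simp only [add_apply, ContinuousLinearMap.comp_apply, map_add,
    ContinuousLinearMap.flip_apply, h2, zero_apply, map_zero] at h1
  exact eq_neg_of_add_eq_zero_left h1

end

end AdaptedFrameBundle

/-! ### The Cartan–Hamilton–Poincaré forms in coordinates -/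

namespace ManifoldForm

/-- The exterior derivative of a `1`-form with values in `ℝ^ι`, componentwise. -/
theorem extDeriv_ofSubsingleton_apply {F : Type*} [NormedAddCommGroup F] [NormedSpace ℝ F]
    {ι : Type*} [Fintype ι] {Θ : F → F →L[ℝ] (ι → ℝ)} {z : F} (hΘ : DifferentiableAt ℝ Θ z)
    (X Y : F) (a : ι) :
    extDeriv (fun z => ContinuousAlternatingMap.ofSubsingleton ℝ F (ι → ℝ) (0 : Fin 1) (Θ z)) z
        ![X, Y] a =
      fderiv ℝ (fun z => Θ z Y a) z X - fderiv ℝ (fun z => Θ z X a) z Y := by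
  have hd : DifferentiableAt ℝ
      (fun z => ContinuousAlternatingMap.ofSubsingleton ℝ F (ι → ℝ) (0 : Fin 1) (Θ z)) z :=
    ((ContinuousAlternatingMap.ofSubsingletonLIE (𝕜 := ℝ) (E := F) (F := ι → ℝ)
      (0 : Fin 1)).differentiable (Θ z)).comp z hΘ
  -- Taking the component `a` is continuous and linear, so it commutes with differentiation.
  have hc : ∀ V : F, ∀ W : F, fderiv ℝ (fun z => Θ z V) z W a = fderiv ℝ (fun z => Θ z V a) z W := by
    intro V W
    have h1 : DifferentiableAt ℝ (fun z => Θ z V) z := hΘ.clm_apply (differentiableAt_const V)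
    have h2 := (ContinuousLinearMap.proj (R := ℝ) (φ := fun _ : ι => ℝ) a).hasFDerivAt.comp z
      h1.hasFDerivAt
    exact (congrArg (fun T => T W) h2.fderiv).symm
  rw [extDeriv_apply hd, Fin.sum_univ_two, ← hc, ← hc, sub_eq_add_neg]
  simp [Fin.removeNth]

end ManifoldForm

namespace AdaptedFrameBundle

section

variable {n k : ℕ}

/-- The coordinate expression of the Cartan-Hamilton-Poincaré forms of a Lagrangian `ℓ` with
momenta `p`. -/
noncomputable def localForm (τ : ℝ) (ℓ : EuclideanSpace ℝ (Fin (n + k)) × FrameModel n k → ℝ)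
    (p : Fin n → Fin k → EuclideanSpace ℝ (Fin (n + k)) × FrameModel n k → ℝ)
    (q : EuclideanSpace ℝ (Fin (n + k)) × FrameModel n k) :
    EuclideanSpace ℝ (Fin (n + k)) × FrameModel n k →L[ℝ] (Fin n ⊕ Fin k → ℝ) :=
  (ContinuousLinearMap.pi (Sum.elim
    (fun i => (τ * ℓ q) • (ContinuousLinearMap.proj (Sum.inl i)).comp (coframe q) +
      ∑ A, p i A q • (ContinuousLinearMap.proj (Sum.inr A)).comp (coframe q))
    (fun A => (ContinuousLinearMap.proj (Sum.inr A)).comp (coframe q)))).comp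
  (ContinuousLinearMap.fst ℝ _ _)

theorem localForm_inl (τ : ℝ) (ℓ : EuclideanSpace ℝ (Fin (n + k)) × FrameModel n k → ℝ)
    (p : Fin n → Fin k → EuclideanSpace ℝ (Fin (n + k)) × FrameModel n k → ℝ)
    (q Y : EuclideanSpace ℝ (Fin (n + k)) × FrameModel n k) (i : Fin n) :
    localForm τ ℓ p q Y (Sum.inl i) = τ * ℓ q * coframe q Y.1 (Sum.inl i) +
      ∑ A, p i A q * coframe q Y.1 (Sum.inr A) := by
  simp [localForm]

theorem localForm_inr (τ : ℝ) (ℓ : EuclideanSpace ℝ (Fin (n + k)) × FrameModel n k → ℝ)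
    (p : Fin n → Fin k → EuclideanSpace ℝ (Fin (n + k)) × FrameModel n k → ℝ)
    (q Y : EuclideanSpace ℝ (Fin (n + k)) × FrameModel n k) (A : Fin k) :
    localForm τ ℓ p q Y (Sum.inr A) = coframe q Y.1 (Sum.inr A) := by
  simp [localForm]

theorem contDiffOn_localForm (τ : ℝ) {ℓ : EuclideanSpace ℝ (Fin (n + k)) × FrameModel n k → ℝ}
    {p : Fin n → Fin k → EuclideanSpace ℝ (Fin (n + k)) × FrameModel n k → ℝ}
    {U : Set (EuclideanSpace ℝ (Fin (n + k)) × FrameModel n k)}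
    (hU : ∀ q ∈ U, (ofBlocks q.2).IsInvertible) (hℓ : ContDiffOn ℝ ∞ ℓ U)
    (hp : ∀ i A, ContDiffOn ℝ ∞ (p i A) U) : ContDiffOn ℝ ∞ (localForm τ ℓ p) U := by
  rw [contDiffOn_clm_apply]
  intro Y
  have hS : ∀ a, ContDiffOn ℝ ∞ (fun q => coframe q Y.1 a) U := fun a =>
    contDiffOn_pi.1 (fun q hq => ((contDiffAt_coframe (hU q hq)).clm_apply
      contDiffAt_const).contDiffWithinAt) a
  rw [contDiffOn_pi]
  rintro (i | A)
  · simp only [localForm_inl]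
    exact ((contDiffOn_const.mul hℓ).mul (hS _)).add
      (ContDiffOn.sum fun A _ => (hp i A).mul (hS _))
  · simpa only [localForm_inr] using hS _

/-- One component of the formula for the derivative of V⁻¹y, in a form that feeds directly into the
product rule. -/
theorem exists_hasFDerivAt_coframe_apply {q : EuclideanSpace ℝ (Fin (n + k)) × FrameModel n k}
    (hq : (ofBlocks q.2).IsInvertible) (y : EuclideanSpace ℝ (Fin (n + k)))
    (a : Fin n ⊕ Fin k) :
    ∃ S' : EuclideanSpace ℝ (Fin (n + k)) × FrameModel n k →L[ℝ] ℝ,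
      HasFDerivAt (fun q' => coframe q' y a) S' q ∧
      ∀ X, S' X = -coframe q (ofBlocks X.2 (coframe q y)) a := by
  have hS : DifferentiableAt ℝ (fun q' => coframe q' y) q :=
    ((contDiffAt_coframe hq).differentiableAt (by simp)).clm_apply (differentiableAt_const y)
  refine ⟨_, (ContinuousLinearMap.proj (R := ℝ) (φ := fun _ : Fin n ⊕ Fin k => ℝ)
    a).hasFDerivAt.comp q hS.hasFDerivAt, fun X => ?_⟩
  have h := congrFun (fderiv_coframe_apply hq y X) a
  exact h

theorem fderiv_localForm_inr (τ : ℝ) (ℓ : EuclideanSpace ℝ (Fin (n + k)) × FrameModel n k → ℝ)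
    (p : Fin n → Fin k → EuclideanSpace ℝ (Fin (n + k)) × FrameModel n k → ℝ)
    {q : EuclideanSpace ℝ (Fin (n + k)) × FrameModel n k} (hq : (ofBlocks q.2).IsInvertible)
    (X Y : EuclideanSpace ℝ (Fin (n + k)) × FrameModel n k) (A : Fin k) :
    fderiv ℝ (fun q => localForm τ ℓ p q Y (Sum.inr A)) q X =
      -coframe q (ofBlocks X.2 (coframe q Y.1)) (Sum.inr A) := by
  obtain ⟨S', hS', hX⟩ := exists_hasFDerivAt_coframe_apply hq Y.1 (Sum.inr A)
  simp only [localForm_inr]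
  rw [hS'.fderiv, hX]

theorem fderiv_localForm_inl (τ : ℝ) {ℓ : EuclideanSpace ℝ (Fin (n + k)) × FrameModel n k → ℝ}
    {p : Fin n → Fin k → EuclideanSpace ℝ (Fin (n + k)) × FrameModel n k → ℝ}
    {q : EuclideanSpace ℝ (Fin (n + k)) × FrameModel n k} (hq : (ofBlocks q.2).IsInvertible)
    (hℓ : DifferentiableAt ℝ ℓ q) (hp : ∀ i A, DifferentiableAt ℝ (p i A) q)
    (X Y : EuclideanSpace ℝ (Fin (n + k)) × FrameModel n k) (i : Fin n) :
    fderiv ℝ (fun q => localForm τ ℓ p q Y (Sum.inl i)) q X =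
      τ * (fderiv ℝ ℓ q X * coframe q Y.1 (Sum.inl i) -
        ℓ q * coframe q (ofBlocks X.2 (coframe q Y.1)) (Sum.inl i)) +
      ∑ A, (fderiv ℝ (p i A) q X * coframe q Y.1 (Sum.inr A) -
        p i A q * coframe q (ofBlocks X.2 (coframe q Y.1)) (Sum.inr A)) := by
  choose S' hS' hX using fun a => exists_hasFDerivAt_coframe_apply hq Y.1 a
  simp only [localForm_inl]
  have h := ((hℓ.hasFDerivAt.const_mul τ).mul (hS' (Sum.inl i))).add
    (HasFDerivAt.fun_sum (u := Finset.univ) fun A _ =>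
      (hp i A).hasFDerivAt.mul (hS' (Sum.inr A)))
  refine (congrArg (fun T => T X) h.fderiv).trans ?_
  simp only [add_apply, smul_apply,
    sum_apply, hX, smul_eq_mul]
  congr 1
  · ring
  · exact Finset.sum_congr rfl fun A _ => by ring

/-- Non-degeneracy of the exterior derivative of the coordinate expression of the
Cartan-Hamilton-Poincaré forms. -/
theorem localForm_nondegenerate (hm : 1 ≤ n + k) {τ : ℝ} (hτ : τ ≠ 0)
    {ℓ : EuclideanSpace ℝ (Fin (n + k)) × FrameModel n k → ℝ}
    {p : Fin n → Fin k → EuclideanSpace ℝ (Fin (n + k)) × FrameModel n k → ℝ}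
    {q : EuclideanSpace ℝ (Fin (n + k)) × FrameModel n k} (hq : (ofBlocks q.2).IsInvertible)
    (hℓ : DifferentiableAt ℝ ℓ q) (hp : ∀ i A, DifferentiableAt ℝ (p i A) q)
    (hΘ : DifferentiableAt ℝ (localForm τ ℓ p) q) (hℓ0 : ℓ q ≠ 0)
    (hh : ∀ i j, fderiv ℝ ℓ q
      (0, verticalDir q.2 (Matrix.single (Sum.inl j) (Sum.inl i) 1)) = 0)
    (X : EuclideanSpace ℝ (Fin (n + k)) × FrameModel n k)
    (hX : ∀ Y, extDeriv (fun q => ContinuousAlternatingMap.ofSubsingleton ℝ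
      (EuclideanSpace ℝ (Fin (n + k)) × FrameModel n k) (Fin n ⊕ Fin k → ℝ) (0 : Fin 1)
      (localForm τ ℓ p q)) q ![X, Y] = 0) : X = 0 := by
  obtain ⟨e, he⟩ := id hq
  have hS : ∀ y, coframe q y = e.symm y := by
    intro y
    rw [coframe, ← he, ContinuousLinearMap.inverse_equiv]
    rfl
  refine eq_zero_of_annihilates hm he hτ hℓ0 (fderiv ℝ ℓ q) hh (fun i A => p i A q)
    (fun i A => fderiv ℝ (p i A) q) (fun Y A => ?_) (fun Y i => ?_)
  · have h := congrFun (hX Y) (Sum.inr A)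
    rw [ManifoldForm.extDeriv_ofSubsingleton_apply hΘ, fderiv_localForm_inr _ _ _ hq,
      fderiv_localForm_inr _ _ _ hq, Pi.zero_apply] at h
    simp only [hS] at h
    linarith
  · have h := congrFun (hX Y) (Sum.inl i)
    rw [ManifoldForm.extDeriv_ofSubsingleton_apply hΘ, fderiv_localForm_inl _ hq hℓ hp,
      fderiv_localForm_inl _ hq hℓ hp, Pi.zero_apply] at h
    simp only [hS] at h
    exact sub_eq_zero.1 h

end

end AdaptedFrameBundle

/-! ### From the frame bundle to coordinates -/

namespace AdaptedFrameBundle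

section

variable {n k : ℕ}
  {M : Type*} [TopologicalSpace M] [ChartedSpace (EuclideanSpace ℝ (Fin n)) M]
  {E : Type*} [TopologicalSpace E] [ChartedSpace (EuclideanSpace ℝ (Fin (n + k))) E]
  {π : E → M} {hπ : Manifold.IsSubmersion (𝓡 (n + k)) (𝓡 n) ∞ π}

theorem velocity_single (φ : OpenPartialHomeomorph E (EuclideanSpace ℝ (Fin (n + k))))
    (u : AdaptedFrameBundle hπ) (a : Fin n ⊕ Fin k) :
    velocity φ u (Pi.single a 1) = chartDeriv φ u.pt (u.frame a) :=
  congrArg (chartDeriv φ u.pt) (frameIso_single u a)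

theorem act_frame (u : AdaptedFrameBundle hπ) (g : Matrix (Fin n ⊕ Fin k) (Fin n ⊕ Fin k) ℝ)
    (hg : IsUnit g.det) (hg' : ∀ (i : Fin n) (A : Fin k), g (Sum.inl i) (Sum.inr A) = 0)
    (a : Fin n ⊕ Fin k) :
    (u.act g hg hg').frame a = ∑ b, g b a • u.frame b := by
  have h : (u.frame.map (Matrix.toLinearEquiv u.frame g hg)) a = ∑ b, g b a • u.frame b := by
    simp [Matrix.toLinearEquiv, Matrix.toLin_self]
  exact h

/-- The components of the frame `u · g` are obtained by right multiplication with `g`. -/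
theorem velocity_act (φ : OpenPartialHomeomorph E (EuclideanSpace ℝ (Fin (n + k))))
    (u : AdaptedFrameBundle hπ) (g : Matrix (Fin n ⊕ Fin k) (Fin n ⊕ Fin k) ℝ)
    (hg : IsUnit g.det) (hg' : ∀ (i : Fin n) (A : Fin k), g (Sum.inl i) (Sum.inr A) = 0) :
    velocity φ (u.act g hg hg') = (velocity φ u).comp (matrixCLM g) := by
  apply ContinuousLinearMap.coe_injective
  refine (Pi.basisFun ℝ (Fin n ⊕ Fin k)).ext fun a => ?_
  have h1 : matrixCLM g (Pi.single a 1) = ∑ b, g b a • Pi.single b (1 : ℝ) := by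
    rw [matrixCLM_apply, Matrix.mulVec_single_one]
    ext c
    simp [Finset.sum_apply, Pi.single_apply]
  have h2 : velocity φ (u.act g hg hg') (Pi.single a 1) =
      velocity φ u (matrixCLM g (Pi.single a 1)) := by
    rw [velocity_single, h1, map_sum]
    refine (congrArg (chartDeriv φ u.pt) (act_frame u g hg hg' a)).trans ?_
    rw [map_sum]
    refine Finset.sum_congr rfl fun b _ => ?_
    rw [map_smul, map_smul, velocity_single]
  simpa using h2

section

attribute [local instance] Matrix.linftyOpNormedRing Matrix.linftyOpNormedAlgebra

/-- The curve exp(tξ) has velocity ξ at t = 0. Composing with a linear map `f` moves the conclusion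
into `W`; the norm on matrices is only an auxiliary choice, hence the local instances. -/
theorem hasDerivAt_linear_exp_smul {W : Type*} [NormedAddCommGroup W] [NormedSpace ℝ W]
    {ι : Type*} [Fintype ι] [DecidableEq ι] (f : Matrix ι ι ℝ →ₗ[ℝ] W) (ξ : Matrix ι ι ℝ) :
    HasDerivAt (fun t : ℝ => f (NormedSpace.exp (t • ξ))) (f ξ) 0 := by
  have h := hasDerivAt_exp_smul_const (𝕂 := ℝ) ξ (0 : ℝ)
  rw [zero_smul, NormedSpace.exp_zero, one_mul] at h
  exact (LinearMap.toContinuousLinearMap f).hasFDerivAt.comp_hasDerivAt (0 : ℝ) h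

end

variable [IsManifold (𝓡 (n + k)) ∞ E] [IsManifold (𝓡 n) ∞ M]

/-- The chart of the manifold `L_π E` induced by an adapted chart of `E`. -/
noncomputable def inducedChart (hπ : Manifold.IsSubmersion (𝓡 (n + k)) (𝓡 n) ∞ π)
    {φ : OpenPartialHomeomorph E (EuclideanSpace ℝ (Fin (n + k)))} (hφ : IsAdaptedChart π φ) :
    OpenPartialHomeomorph (AdaptedFrameBundle hπ)
      (EuclideanSpace ℝ (Fin (n + k)) × FrameModel n k) :=
  (chartedSpaceCore hπ).openPartialHomeomorph (frameChart hπ hφ) ⟨φ, hφ, rfl⟩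

/-- This reduces every statement about all charts of the atlas to the coordinates (z, V). -/
theorem mem_atlas_iff
    {c : OpenPartialHomeomorph (AdaptedFrameBundle hπ)
      (EuclideanSpace ℝ (Fin (n + k)) × FrameModel n k)} :
    c ∈ atlas (EuclideanSpace ℝ (Fin (n + k)) × FrameModel n k) (AdaptedFrameBundle hπ) ↔
      ∃ (φ : OpenPartialHomeomorph E (EuclideanSpace ℝ (Fin (n + k))))
        (hφ : IsAdaptedChart π φ), c = inducedChart hπ hφ := by
  constructor
  · intro hc
    obtain ⟨c', hc', rfl⟩ : ∃ c', ∃ h : c' ∈ (chartedSpaceCore hπ).atlas,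
        c = (chartedSpaceCore hπ).openPartialHomeomorph c' h := by
      simpa [atlas, ChartedSpace.atlas, ChartedSpaceCore.toChartedSpace] using hc
    obtain ⟨φ, hφ, rfl⟩ := id hc'
    exact ⟨φ, hφ, rfl⟩
  · rintro ⟨φ, hφ, rfl⟩
    have : ∃ c', ∃ h : c' ∈ (chartedSpaceCore hπ).atlas,
        inducedChart hπ hφ = (chartedSpaceCore hπ).openPartialHomeomorph c' h :=
      ⟨_, ⟨φ, hφ, rfl⟩, rfl⟩
    simpa [atlas, ChartedSpace.atlas, ChartedSpaceCore.toChartedSpace] using this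

variable {φ : OpenPartialHomeomorph E (EuclideanSpace ℝ (Fin (n + k)))}

theorem inducedChart_apply (hφ : IsAdaptedChart π φ) (u : AdaptedFrameBundle hπ) :
    inducedChart hπ hφ u = coord φ u := rfl

theorem coord_inducedChart_symm (hφ : IsAdaptedChart π φ)
    {q : EuclideanSpace ℝ (Fin (n + k)) × FrameModel n k}
    (hq : q ∈ (inducedChart hπ hφ).target) : coord φ ((inducedChart hπ hφ).symm q) = q :=
  (inducedChart hπ hφ).right_inv hq

theorem pt_inducedChart_symm_mem (hφ : IsAdaptedChart π φ)
    {q : EuclideanSpace ℝ (Fin (n + k)) × FrameModel n k}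
    (hq : q ∈ (inducedChart hπ hφ).target) : ((inducedChart hπ hφ).symm q).pt ∈ φ.source :=
  (inducedChart hπ hφ).map_target hq

theorem pt_inducedChart_symm (hφ : IsAdaptedChart π φ)
    {q : EuclideanSpace ℝ (Fin (n + k)) × FrameModel n k}
    (hq : q ∈ (inducedChart hπ hφ).target) :
    ((inducedChart hπ hφ).symm q).pt = φ.symm q.1 := by
  have h1 : φ ((inducedChart hπ hφ).symm q).pt = q.1 :=
    congrArg Prod.fst (coord_inducedChart_symm hφ hq)
  rw [← h1, φ.left_inv (pt_inducedChart_symm_mem hφ hq)]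

theorem velocity_inducedChart_symm (hφ : IsAdaptedChart π φ)
    {q : EuclideanSpace ℝ (Fin (n + k)) × FrameModel n k}
    (hq : q ∈ (inducedChart hπ hφ).target) :
    velocity φ ((inducedChart hπ hφ).symm q) = ofBlocks q.2 := by
  rw [← ofBlocks_coord hφ _ (pt_inducedChart_symm_mem hφ hq), coord_inducedChart_symm hφ hq]

/-- The coordinate expression of the derivative along a fundamental vertical vector field. -/
theorem fundamentalDeriv_inducedChart_symm (hφ : IsAdaptedChart π φ)
    {L : AdaptedFrameBundle hπ → ℝ} {q : EuclideanSpace ℝ (Fin (n + k)) × FrameModel n k}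
    (hq : q ∈ (inducedChart hπ hφ).target)
    (hL : DifferentiableAt ℝ (L ∘ (inducedChart hπ hφ).symm) q)
    (ξ : Matrix (Fin n ⊕ Fin k) (Fin n ⊕ Fin k) ℝ)
    (hξ : ∀ (i : Fin n) (A : Fin k), ξ (Sum.inl i) (Sum.inr A) = 0) :
    fundamentalDeriv ξ hξ L ((inducedChart hπ hφ).symm q) =
      fderiv ℝ (L ∘ (inducedChart hπ hφ).symm) q (0, verticalDir q.2 ξ) := by
  set u := (inducedChart hπ hφ).symm q with hu
  have hus : u.pt ∈ φ.source := pt_inducedChart_symm_mem hφ hq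
  -- In coordinates the orbit fixes z and sends V to V exp(tξ), which is linear in the exponential.
  have hcurve : ∀ t : ℝ,
      coord φ (u.act (NormedSpace.exp (t • ξ)) (isUnit_det_exp _) (exp_lower hξ t)) =
        (q.1, verticalDir q.2 (NormedSpace.exp (t • ξ))) := by
    intro t
    have h0 : φ u.pt = q.1 := congrArg Prod.fst (coord_inducedChart_symm hφ hq)
    refine Prod.ext h0 ?_
    change blocks (velocity φ _) = _
    rw [velocity_act, velocity_inducedChart_symm hφ hq, verticalDir_apply]
  have hfun : (fun t : ℝ =>
      L (u.act (NormedSpace.exp (t • ξ)) (isUnit_det_exp _) (exp_lower hξ t))) =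
      fun t : ℝ => (L ∘ (inducedChart hπ hφ).symm)
        (q.1, verticalDir q.2 (NormedSpace.exp (t • ξ))) := by
    funext t
    have hs : u.act (NormedSpace.exp (t • ξ)) (isUnit_det_exp _) (exp_lower hξ t) ∈
        (inducedChart hπ hφ).source := hus
    rw [← hcurve t, Function.comp_apply, ← inducedChart_apply hφ,
      (inducedChart hπ hφ).left_inv hs]
  have hcurve0 : (q.1, verticalDir q.2 (NormedSpace.exp ((0 : ℝ) • ξ))) = q := by
    refine Prod.ext rfl ?_
    have h1 : (matrixCLM (1 : Matrix (Fin n ⊕ Fin k) (Fin n ⊕ Fin k) ℝ)) =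
        ContinuousLinearMap.id ℝ _ := by
      ext w
      simp [matrixCLM_apply]
    rw [zero_smul, NormedSpace.exp_zero, verticalDir_apply, h1, ContinuousLinearMap.comp_id,
      blocks_ofBlocks]
  have hderiv : HasDerivAt (fun t : ℝ => (q.1, verticalDir q.2 (NormedSpace.exp (t • ξ))))
      (0, verticalDir q.2 ξ) 0 :=
    (hasDerivAt_const (0 : ℝ) q.1).prodMk (hasDerivAt_linear_exp_smul (verticalDir q.2) ξ)
  rw [fundamentalDeriv, hfun]
  -- The chain rule asks for the derivative of ℓ at the value of the curve at t = 0, which equals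
  -- `q` only after simplification.
  have hL' : HasFDerivAt (L ∘ (inducedChart hπ hφ).symm)
      (fderiv ℝ (L ∘ (inducedChart hπ hφ).symm) q)
      (q.1, verticalDir q.2 (NormedSpace.exp ((0 : ℝ) • ξ))) := by
    rw [hcurve0]
    exact hL.hasFDerivAt
  exact (hL'.comp_hasDerivAt (0 : ℝ) hderiv).deriv

theorem contDiffOn_comp_inducedChart_symm (hφ : IsAdaptedChart π φ)
    {L : AdaptedFrameBundle hπ → ℝ}
    (hL : ContMDiff 𝓘(ℝ, EuclideanSpace ℝ (Fin (n + k)) × FrameModel n k) 𝓘(ℝ, ℝ) ∞ L) :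
    ContDiffOn ℝ ∞ (L ∘ (inducedChart hπ hφ).symm) (inducedChart hπ hφ).target := by
  rw [← contMDiffOn_iff_contDiffOn]
  exact hL.comp_contMDiffOn (contMDiffOn_symm_of_mem_maximalAtlas
    (IsManifold.subset_maximalAtlas (mem_atlas_iff.2 ⟨φ, hφ, rfl⟩)))

/-- The coordinate expression of the differential of the projection `L_π E → E`. -/
theorem mfderiv_pt_comp_inducedChart_symm (hφ : IsAdaptedChart π φ)
    {q : EuclideanSpace ℝ (Fin (n + k)) × FrameModel n k}
    (hq : q ∈ (inducedChart hπ hφ).target)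
    (Y : EuclideanSpace ℝ (Fin (n + k)) × FrameModel n k) :
    chartDeriv φ ((inducedChart hπ hφ).symm q).pt
      (mfderiv 𝓘(ℝ, EuclideanSpace ℝ (Fin (n + k)) × FrameModel n k) (𝓡 (n + k))
        (AdaptedFrameBundle.pt : AdaptedFrameBundle hπ → E) ((inducedChart hπ hφ).symm q)
        (mfderiv 𝓘(ℝ, EuclideanSpace ℝ (Fin (n + k)) × FrameModel n k)
          𝓘(ℝ, EuclideanSpace ℝ (Fin (n + k)) × FrameModel n k)
          (inducedChart hπ hφ).symm q Y)) = Y.1 := by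
  set c := inducedChart hπ hφ with hc
  have hcd : c.MDifferentiable 𝓘(ℝ, EuclideanSpace ℝ (Fin (n + k)) × FrameModel n k)
      𝓘(ℝ, EuclideanSpace ℝ (Fin (n + k)) × FrameModel n k) :=
    ManifoldForm.mdifferentiable_of_mem_atlas (mem_atlas_iff.2 ⟨φ, hφ, rfl⟩)
  have hsymm := hcd.mdifferentiableAt_symm hq
  have hus : c.symm q ∈ c.source := c.map_target hq
  have hpt : MDifferentiableAt 𝓘(ℝ, EuclideanSpace ℝ (Fin (n + k)) × FrameModel n k) (𝓡 (n + k))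
      (AdaptedFrameBundle.pt : AdaptedFrameBundle hπ → E) (c.symm q) := by
    -- Differentiability of the projection comes from its local form: in the charts `c` and `φ` it
    -- is (z, V) ↦ z.
    have h1 : (AdaptedFrameBundle.pt : AdaptedFrameBundle hπ → E) =ᶠ[𝓝 (c.symm q)]
        φ.symm ∘ (Prod.fst ∘ c) := by
      filter_upwards [c.open_source.mem_nhds hus] with u hu
      exact (φ.left_inv hu).symm
    refine MDifferentiableAt.congr_of_eventuallyEq ?_ h1
    refine MDifferentiableAt.comp (I' := 𝓡 (n + k)) _
      (hφ.mdifferentiable.mdifferentiableAt_symm ?_) ?_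
    · exact φ.map_source hus
    · refine MDifferentiableAt.comp
        (I' := 𝓘(ℝ, EuclideanSpace ℝ (Fin (n + k)) × FrameModel n k)) _ ?_
        (hcd.mdifferentiableAt hus)
      exact differentiableAt_fst.mdifferentiableAt
  have hφd : MDifferentiableAt (𝓡 (n + k)) (𝓡 (n + k)) φ (c.symm q).pt :=
    hφ.mdifferentiable.mdifferentiableAt hus
  have h2 := mfderiv_comp q (hφd.comp _ hpt) hsymm
  rw [mfderiv_comp _ hφd hpt] at h2
  have h3 : (φ ∘ AdaptedFrameBundle.pt) ∘ c.symm =ᶠ[𝓝 q] Prod.fst := by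
    filter_upwards [c.open_target.mem_nhds hq] with q' hq'
    exact congrArg Prod.fst (coord_inducedChart_symm hφ hq')
  rw [h3.mfderiv_eq, mfderiv_eq_fderiv, fderiv_fst] at h2
  exact (congrArg (fun T => T Y) h2).symm

/-- The coordinate expression of the soldering form. -/
theorem soldering_inducedChart_symm (hφ : IsAdaptedChart π φ)
    {q : EuclideanSpace ℝ (Fin (n + k)) × FrameModel n k}
    (hq : q ∈ (inducedChart hπ hφ).target)
    (Y : EuclideanSpace ℝ (Fin (n + k)) × FrameModel n k) :
    soldering ((inducedChart hπ hφ).symm q)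
      (mfderiv 𝓘(ℝ, EuclideanSpace ℝ (Fin (n + k)) × FrameModel n k)
        𝓘(ℝ, EuclideanSpace ℝ (Fin (n + k)) × FrameModel n k)
        (inducedChart hπ hφ).symm q Y) = coframe q Y.1 := by
  have h1 := mfderiv_pt_comp_inducedChart_symm hφ hq Y
  set u := (inducedChart hπ hφ).symm q with hu
  set Z := mfderiv 𝓘(ℝ, EuclideanSpace ℝ (Fin (n + k)) × FrameModel n k) (𝓡 (n + k))
    (AdaptedFrameBundle.pt : AdaptedFrameBundle hπ → E) u
    (mfderiv 𝓘(ℝ, EuclideanSpace ℝ (Fin (n + k)) × FrameModel n k)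
      𝓘(ℝ, EuclideanSpace ℝ (Fin (n + k)) × FrameModel n k) (inducedChart hπ hφ).symm q Y)
  change u.frameIso.symm Z = _
  have h2 : velocity φ u (u.frameIso.symm Z) = Y.1 := by
    rw [← h1]
    exact congrArg (chartDeriv φ u.pt) (u.frameIso.apply_symm_apply Z)
  rw [velocity_inducedChart_symm hφ hq] at h2
  rw [← h2]
  -- By the construction of the chart, the second half of membership in its target is invertibility
  -- of V.
  exact (hq.2.inverse_apply_self _).symm

/-- The coordinate expression of the covariant momenta of a Lagrangian. -/
noncomputable def localMomentum (ℓ : EuclideanSpace ℝ (Fin (n + k)) × FrameModel n k → ℝ)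
    (i : Fin n) (A : Fin k) (q : EuclideanSpace ℝ (Fin (n + k)) × FrameModel n k) : ℝ :=
  fderiv ℝ ℓ q (0, verticalDir q.2 (Matrix.single (Sum.inr A) (Sum.inl i) 1))

/-- Both dℓ and the direction (0, Vξ), which is linear in V, depend smoothly on the point;
differentiating once costs nothing at order ∞. -/
theorem contDiffOn_localMomentum {ℓ : EuclideanSpace ℝ (Fin (n + k)) × FrameModel n k → ℝ}
    {U : Set (EuclideanSpace ℝ (Fin (n + k)) × FrameModel n k)} (hU : IsOpen U)
    (hℓ : ContDiffOn ℝ ∞ ℓ U) (i : Fin n) (A : Fin k) :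
    ContDiffOn ℝ ∞ (localMomentum ℓ i A) U := by
  have h1 : ContDiff ℝ ∞ fun q : EuclideanSpace ℝ (Fin (n + k)) × FrameModel n k =>
      verticalDir q.2 (Matrix.single (Sum.inr A) (Sum.inl i) 1) :=
    (LinearMap.toContinuousLinearMap (blocks (n := n) (k := k))).contDiff.comp
      (contDiff_ofBlocks_snd.clm_comp contDiff_const)
  exact (hℓ.fderiv_of_isOpen hU (by simp)).clm_apply
    (contDiff_const.prodMk h1).contDiffOn

/-- The coordinate expression of the Cartan-Hamilton-Poincaré forms. -/
theorem inChart_chpForm (hφ : IsAdaptedChart π φ) (τ : ℝ) {L : AdaptedFrameBundle hπ → ℝ}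
    (hL : ContMDiff 𝓘(ℝ, EuclideanSpace ℝ (Fin (n + k)) × FrameModel n k) 𝓘(ℝ, ℝ) ∞ L)
    {q : EuclideanSpace ℝ (Fin (n + k)) × FrameModel n k}
    (hq : q ∈ (inducedChart hπ hφ).target) :
    ManifoldForm.inChart (ManifoldForm.ofOneForm (chpForm τ L)) (inducedChart hπ hφ) q =
      ContinuousAlternatingMap.ofSubsingleton ℝ
        (EuclideanSpace ℝ (Fin (n + k)) × FrameModel n k) (Fin n ⊕ Fin k → ℝ) (0 : Fin 1)
        (localForm τ (L ∘ (inducedChart hπ hφ).symm)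
          (localMomentum (L ∘ (inducedChart hπ hφ).symm)) q) := by
  have hLd : DifferentiableAt ℝ (L ∘ (inducedChart hπ hφ).symm) q :=
    ((contDiffOn_comp_inducedChart_symm hφ hL).contDiffAt
      ((inducedChart hπ hφ).open_target.mem_nhds hq)).differentiableAt (by simp)
  ext v a
  have hS := soldering_inducedChart_symm hφ hq (v 0)
  change chpForm τ L ((inducedChart hπ hφ).symm q)
    (mfderiv 𝓘(ℝ, EuclideanSpace ℝ (Fin (n + k)) × FrameModel n k)
        𝓘(ℝ, EuclideanSpace ℝ (Fin (n + k)) × FrameModel n k)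
        (inducedChart hπ hφ).symm q (v 0)) a =
    localForm τ (L ∘ (inducedChart hπ hφ).symm)
          (localMomentum (L ∘ (inducedChart hπ hφ).symm)) q (v 0) a
  rcases a with i | A
  · rw [localForm_inl, ← hS]
    simp [chpForm, localMomentum, momentum, fundamentalDeriv_inducedChart_symm hφ hq hLd]
  · rw [localForm_inr, ← hS]
    simp [chpForm]

end

end AdaptedFrameBundle

/-! ### The m-symplectic structure on the adapted frame bundle -/

theorem mainTheorem12 {n k : ℕ} (hm : 1 ≤ n + k)
    {M : Type*} [TopologicalSpace M] [ChartedSpace (EuclideanSpace ℝ (Fin n)) M]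
    [IsManifold (𝓡 n) ∞ M]
    {E : Type*} [TopologicalSpace E] [ChartedSpace (EuclideanSpace ℝ (Fin (n + k))) E]
    [IsManifold (𝓡 (n + k)) ∞ E]
    {π : E → M} (hπ : Manifold.IsSubmersion (𝓡 (n + k)) (𝓡 n) ∞ π)
    (τ : ℕ → ℝ) (hτ : 0 < τ n)
    (L : AdaptedFrameBundle hπ → ℝ) (hL : AdaptedFrameBundle.IsLiftedLagrangian L)
    (hL0 : ∀ u, L u ≠ 0) :
    ManifoldForm.IsMSymplectic (ι := Fin n ⊕ Fin k) (P := AdaptedFrameBundle hπ)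
      (ManifoldForm.d (ManifoldForm.ofOneForm (AdaptedFrameBundle.chpForm (τ n) L))) := by
  have hsmooth : ∀ {φ : OpenPartialHomeomorph E (EuclideanSpace ℝ (Fin (n + k)))}
      (hφ : AdaptedFrameBundle.IsAdaptedChart π φ),
      ContDiffOn ℝ ∞ (AdaptedFrameBundle.localForm (τ n)
        (L ∘ (AdaptedFrameBundle.inducedChart hπ hφ).symm)
        (AdaptedFrameBundle.localMomentum (L ∘ (AdaptedFrameBundle.inducedChart hπ hφ).symm)))
        (AdaptedFrameBundle.inducedChart hπ hφ).target := fun hφ =>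
    AdaptedFrameBundle.contDiffOn_localForm _ (fun q hq => hq.2)
      (AdaptedFrameBundle.contDiffOn_comp_inducedChart_symm hφ hL.smooth)
      (AdaptedFrameBundle.contDiffOn_localMomentum
        (AdaptedFrameBundle.inducedChart hπ hφ).open_target
        (AdaptedFrameBundle.contDiffOn_comp_inducedChart_symm hφ hL.smooth))
  have hα : ManifoldForm.IsSmooth
      (ManifoldForm.ofOneForm (AdaptedFrameBundle.chpForm (τ n) L)) := by
    intro c hc
    obtain ⟨φ, hφ, rfl⟩ := AdaptedFrameBundle.mem_atlas_iff.1 hc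
    exact ((ContinuousAlternatingMap.ofSubsingletonLIE (𝕜 := ℝ) (0 : Fin 1)).contDiff.comp_contDiffOn
      (hsmooth hφ)).congr fun q hq => AdaptedFrameBundle.inChart_chpForm hφ _ hL.smooth hq
  refine ⟨inferInstance, ?_, ?_, hα.d, hα.d_d, ManifoldForm.d_nondegenerate ?_⟩
  · simpa using hm
  · simp only [Fintype.card_sum, Fintype.card_fin, Module.finrank_prod,
      finrank_euclideanSpace_fin]
    -- The coordinates of the base point alone contribute n + k to the dimension.
    exact Nat.le_add_right _ _
  · intro c hc q hq X hX
    obtain ⟨φ, hφ, rfl⟩ := AdaptedFrameBundle.mem_atlas_iff.1 hc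
    have hnhds := (AdaptedFrameBundle.inducedChart hπ hφ).open_target.mem_nhds hq
    have hℓ := (AdaptedFrameBundle.contDiffOn_comp_inducedChart_symm hφ hL.smooth)
    have hℓd := (hℓ.contDiffAt hnhds).differentiableAt (by simp)
    -- Equality of the local representatives is needed near `q`, not just at `q`, because `extDeriv`
    -- differentiates them.
    have hev := Filter.eventuallyEq_of_mem hnhds fun q' hq' =>
      AdaptedFrameBundle.inChart_chpForm hφ (τ n) hL.smooth hq'
    rw [hev.extDeriv_eq] at hX
    refine AdaptedFrameBundle.localForm_nondegenerate hm hτ.ne' hq.2 hℓd (fun i A =>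
      ((AdaptedFrameBundle.contDiffOn_localMomentum
        (AdaptedFrameBundle.inducedChart hπ hφ).open_target hℓ i A).contDiffAt
          hnhds).differentiableAt (by simp))
      (((hsmooth hφ).contDiffAt hnhds).differentiableAt (by simp)) (hL0 _) (fun i j => ?_) X hX
    -- The coordinate condition on dℓ is E^{*i}_j(L) = 0 read in the chart.
    rw [← AdaptedFrameBundle.fundamentalDeriv_inducedChart_symm hφ hq hℓd _ (by simp)]
    exact hL.horizontalDeriv_eq_zero i j _
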